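/- Let $M$ be a compact connected finite-dimensional (boundaryless) Riemannian manifold with Riemannian distance and balls $B_\rho(x)$, and let $\mathrm{Leb}$ be a normalised volume on $M$ (a Borel probability measure having a continuous positive density in charts). Let $f:M\to M$ be continuous on a set $Y\subset M$ of full $\mathrm{Leb}$-measure, and suppose there is $x_0\in M$ whose forward orbit $\{f^nx_0:n\ge 0\}$ is dense in $M$ and contained in $Y$. Consider either of the following two situations. (a) *Random maps.* $X$ is a compact metric space, $\omega^*\in X$, $\theta$ is a Borel probability measure on $X$ whose support contains a ball of positive radius around $\omega^*$, and $(x,\omega)\mapsto f_\omega(x)$ is a measurable map $M\times X\to M$ with $f_{\omega^*}=f$. Write $f^x(\omega)=f_\omega(x)$ and $p_x=(f^x)_*\theta$. There are constants $\rho_0>0$ and $\overline q>\underline q>0$ such that for $\mathrm{Leb}$-a.e. $x$: $\operatorname{supp}(p_x)\supset B_{\rho_0}(f(x))$ (if $\omega\mapsto f_\omega(x)$ is continuous, $\operatorname{supp}(p_x)=f^x(\operatorname{supp}\theta)$), and $p_x=q_x\,\mathrm{Leb}$ with $\underline q\le q_x\le\overline q$ $\mathrm{Leb}$-a.e. on $\operatorname{supp}(p_x)$.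 Let $\mu$ be a stationary probability measure, i.e. $\int p_x(A)\,d\mu(x)=\mu(A)$ for every Borel set $A$, such that $p_x\ll\mathrm{Leb}$ also for $\mu$-a.e. $x$. On $(M\times X^{\mathbb N},\ \mathbb P=\mu\times\theta^{\mathbb N})$ let $Z_n(x,\underline\omega)=f_{\omega_n}\circ\cdots\circ f_{\omega_1}(x)$, $Z_0(x,\underline\omega)=x$. (b) *Markov chains.* $(q_x)_{x\in M}$ is a family of positive Hölder continuous probability densities with respect to $\mathrm{Leb}$, varying continuously with $x$ in the $C^0$ topology, and there are $\rho_0>0$ and $\overline q>\underline q>0$ such that $\operatorname{supp}(q_x)\supset B_{\rho_0}(f(x))$ and $\underline q\le q_x\le\overline q$ for every $x\in Y$. Put $p_x=q_x\,\mathrm{Leb}$, let $\mu$ be a stationary probability measure for $(p_x)$, and let $(Z_n)_{n\ge0}$ be any Markov chain, on any probability space with probability $\mathbb P$, with initial law $\mu$ and transition probabilities $(p_x)$ (for instance $Z_n=f^n_{\underline\omega}$ for a representation of $(p_x)$ by random maps). Let $\zeta\in M$ and let $\varphi:M\to\mathbb R\cup\{\pm\infty\}$ be measurable with a global maximum at $\zeta$,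 $\varphi(\zeta)\in\mathbb R\cup\{+\infty\}$, such that $\{\varphi>u\}$ is a topological ball centred at $\zeta$ for all $u<\varphi(\zeta)$ close enough to $\varphi(\zeta)$, and such that $u\mapsto\mu\{\varphi>u\}$ is continuous in a neighbourhood of $\varphi(\zeta)$. Let $X_n=\varphi\circ Z_n$ and $M_n=\max\{X_0,\dots,X_{n-1}\}$. Then for every $\tau>0$ and all real levels $(u_n)$ with $n\,\mathbb P(X_0>u_n)\to\tau$ the following hold. 1. ($D_2(u_n)$) There are $\gamma(n,t)$, nonincreasing in $t$ for each $n$, and $t_n=o(n)$ with $n\gamma(n,t_n)\to0$ such that for all $\ell,t,n$ $$\bigl|\mathbb P(X_0>u_n,\ \max\{X_t,\dots,X_{t+\ell-1}\}\le u_n)-\mathbb P(X_0>u_n)\,\mathbb P(M_\ell\le u_n)\bigr|\le\gamma(n,t).$$ 2. ($D'(u_n)$) For the same $(t_n)$ there are integers $k_n\to\infty$ with $k_nt_n=o(n)$ and $$\lim_{n\to\infty}n\sum_{j=1}^{\lfloor n/k_n\rfloor}\mathbb P(X_0>u_n,\ X_j>u_n)=0.$$ 3. $\mathbb P(M_n\le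 u_n)\to e^{-\tau}$. Moreover $M_n$ has the extreme value law $H(\tau)=1-e^{-\tau}$ ($\tau\ge 0$; $H=0$ on $(-\infty,0)$), i.e. $\bar H(\tau)=1-H(\tau)=e^{-\tau}$: $H$ is a non-degenerate distribution function with $H(0)=0$, and for every $\tau>0$ there are levels $u_n$ with $n\,\mathbb P(X_0>u_n)\to\tau$ and $\mathbb P(M_n\le u_n)\to\bar H(\tau)$. -/

import Mathlib

open MeasureTheory Filter Set Topology
open scoped Manifold ContDiff Bundle ENNReal NNReal

namespace RandomEVL

noncomputable section

/-- `m` is a normalised volume on the manifold `M`: a Borel probability measure which in each chart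
of the atlas has a continuous, strictly positive density with respect to Lebesgue measure. -/
structure IsNormalizedVolume (d : ℕ) {M : Type*} [TopologicalSpace M]
    [ChartedSpace (EuclideanSpace ℝ (Fin d)) M] [MeasurableSpace M] (m : Measure M) : Prop where
  prob : IsProbabilityMeasure m
  density : ∀ e ∈ atlas (EuclideanSpace ℝ (Fin d)) M,
    ∃ ρ : EuclideanSpace ℝ (Fin d) → ℝ, ContinuousOn ρ e.target ∧ (∀ y ∈ e.target, 0 < ρ y) ∧
      ∀ A ⊆ e.source, MeasurableSet A → m A = ∫⁻ y in e '' A, ENNReal.ofReal (ρ y)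

/-- `μ` is stationary for the transition probabilities `(p x)`: `∫ p_x(A) dμ(x) = μ(A)`. -/
def IsStationaryMeasure {M : Type*} [MeasurableSpace M] (p : M → Measure M) (μ : Measure M) : Prop :=
  ∀ A, MeasurableSet A → ∫⁻ x, p x A ∂μ = μ A

/-! ### Random maps -/

/-- The family `f_ω = F · ω`, with noise distribution `θ`, is a uniformly continuous random
perturbation of `f` (with respect to the reference volume `m`).  The transition probability at `x`
is `(f^x)_* θ`, where `f^x ω = F x ω`. When `F x` is continuous, `F x '' θ.support` is the support
of `θ.map (F x)`, so that `cover` says that `f^x(supp θ)` contains the ball. -/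
structure IsRandomPerturbation {M X : Type*} [PseudoMetricSpace M] [MeasurableSpace M]
    [PseudoMetricSpace X] [MeasurableSpace X] (m : Measure M) (f : M → M)
    (F : M → X → M) (ωstar : X) (θ : Measure X) : Prop where
  prob : IsProbabilityMeasure θ
  measurable : Measurable (Function.uncurry F)
  noise_support : ∃ ε₀ > 0, Metric.ball ωstar ε₀ ⊆ θ.support
  unperturbed : ∀ x, F x ωstar = f x
  cover : ∃ ρ₀ > 0, ∀ᵐ x ∂m, Metric.ball (f x) ρ₀ ⊆ (θ.map (F x)).support
  density : ∃ qlow qup : ℝ, 0 < qlow ∧ qlow < qup ∧ ∀ᵐ x ∂m, ∃ q : M → ℝ, Measurable q ∧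
    θ.map (F x) = m.withDensity (fun y => ENNReal.ofReal (q y)) ∧
    ∀ᵐ y ∂m, y ∈ (θ.map (F x)).support → qlow ≤ q y ∧ q y ≤ qup

/-- The random orbit `f_{ω_n} ∘ ⋯ ∘ f_{ω_1} (x)`; the realisation `ω_1, ω_2, …` is indexed from
`0`, that is, `ω_{i+1}` is `w i`. -/
def randomOrbit {M X : Type*} (F : M → X → M) (w : ℕ → X) : ℕ → M → M
  | 0, x => x
  | n + 1, x => F (randomOrbit F w n x) (w n)

/-! ### Markov chains -/

/-- The transition probability `p_x = q_x m`. -/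
def densityTransition {M : Type*} [TopologicalSpace M] [MeasurableSpace M] (m : Measure M)
    (q : C(M, C(M, ℝ))) (x : M) : Measure M :=
  m.withDensity fun y => ENNReal.ofReal (q x y)

/-- The family `(q_x)` of positive Hölder continuous probability densities, which varies
continuously with `x` in the `C⁰` topology (the topology of `C(M, ℝ)`, `M` being compact), is a
perturbation of `f`, uniformly on the set `Y`. -/
structure IsMarkovPerturbation {M : Type*} [PseudoMetricSpace M] [MeasurableSpace M]
    (m : Measure M) (f : M → M) (Y : Set M) (q : C(M, C(M, ℝ))) : Prop where
  pos : ∀ x y, 0 < q x y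
  holder : ∀ x, ∃ C α : ℝ≥0, 0 < α ∧ HolderWith C α (q x)
  prob : ∀ x, ∫ y, q x y ∂m = 1
  cover : ∃ ρ₀ > 0, ∀ x ∈ Y, Metric.ball (f x) ρ₀ ⊆ tsupport (q x)
  bounds : ∃ qlow qup : ℝ, 0 < qlow ∧ qlow < qup ∧ ∀ x ∈ Y, ∀ y, qlow ≤ q x y ∧ q x y ≤ qup

/-- `Z` is, under `P`, a Markov chain with initial distribution `μ` and transition probabilities
`(p x)`: given `Z_0, …, Z_n`, the law of `Z_{n+1}` is `p_{Z_n}`. -/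
structure IsMarkovChain {M Ω : Type*} [MeasurableSpace M] [MeasurableSpace Ω]
    (p : M → Measure M) (μ : Measure M) (P : Measure Ω) (Z : ℕ → Ω → M) : Prop where
  prob : IsProbabilityMeasure P
  measurable : ∀ n, Measurable (Z n)
  initial : P.map (Z 0) = μ
  step : ∀ (n : ℕ) (B : Set (Fin (n + 1) → M)) (A : Set M), MeasurableSet B → MeasurableSet A →
    P {w | (fun i : Fin (n + 1) => Z i w) ∈ B ∧ Z (n + 1) w ∈ A} =
      ∫⁻ w in {w | (fun i : Fin (n + 1) => Z i w) ∈ B}, p (Z n w) A ∂P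

/-! ### The observable -/

/-- `U` is a topological ball centred at `ζ`: an open set which is the homeomorphic image of the
open unit ball of `ℝ^d`, the origin being mapped to `ζ`. -/
def IsTopologicalBall (d : ℕ) {M : Type*} [TopologicalSpace M] (U : Set M) (ζ : M) : Prop :=
  ∃ e : OpenPartialHomeomorph (EuclideanSpace ℝ (Fin d)) M,
    e.source = Metric.ball 0 1 ∧ e.target = U ∧ e 0 = ζ

/-- `φ : M → ℝ ∪ {±∞}` is measurable, has a global maximum at `ζ` (`φ ζ = +∞` is allowed), the sets
`{φ > u}` are topological balls centred at `ζ` for `u < φ ζ` close to `φ ζ`, and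
`μ {φ > u}` is continuous as a function of the level `u` in a neighbourhood of `φ ζ`. -/
structure IsRegularObservable (d : ℕ) {M : Type*} [TopologicalSpace M] [MeasurableSpace M]
    (μ : Measure M) (φ : M → EReal) (ζ : M) : Prop where
  measurable : Measurable φ
  max : ∀ x, φ x ≤ φ ζ
  ne_bot : φ ζ ≠ ⊥
  ball : ∀ᶠ u in 𝓝[<] (φ ζ), IsTopologicalBall d {x | u < φ x} ζ
  continuous : ∀ᶠ u in 𝓝 (φ ζ), ContinuousAt (fun v : EReal => μ {x | v < φ x}) u

/-! ### Extreme values of a stochastic process -/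

section Extremes

variable {Ω : Type*} [MeasurableSpace Ω]

/-- `max {X_t, …, X_{t+ℓ-1}}`, which is `-∞` if `ℓ = 0`. -/
def blockMax (X : ℕ → Ω → EReal) (t ℓ : ℕ) (w : Ω) : EReal :=
  (Finset.Ico t (t + ℓ)).sup fun i => X i w

/-- `M_n = max {X_0, …, X_{n-1}}`. -/
def partialMax (X : ℕ → Ω → EReal) (n : ℕ) (w : Ω) : EReal :=
  (Finset.range n).sup fun i => X i w

/-- The levels `u_n` satisfy `n P(X_0 > u_n) → τ`. -/
def IsNormalizing (P : Measure Ω) (X : ℕ → Ω → EReal) (τ : ℝ) (u : ℕ → ℝ) : Prop :=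
  Tendsto (fun n : ℕ => (n : ℝ) * P.real {w | (u n : EReal) < X 0 w}) atTop (𝓝 τ)

/-- The condition `D₂(u_n)`, with the mixing rates `γ(n,t)` and the sequence `t_n = o(n)`. -/
structure CondD2 (P : Measure Ω) (X : ℕ → Ω → EReal) (u : ℕ → ℝ) (γ : ℕ → ℕ → ℝ)
    (t : ℕ → ℕ) : Prop where
  bound : ∀ ℓ s n : ℕ,
    |P.real {w | (u n : EReal) < X 0 w ∧ blockMax X s ℓ w ≤ (u n : EReal)}
      - P.real {w | (u n : EReal) < X 0 w} * P.real {w | partialMax X ℓ w ≤ (u n : EReal)}|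
      ≤ γ n s
  antitone : ∀ n, Antitone (γ n)
  isLittleO : (fun n : ℕ => (t n : ℝ)) =o[atTop] (fun n : ℕ => (n : ℝ))
  tendsto : Tendsto (fun n : ℕ => (n : ℝ) * γ n (t n)) atTop (𝓝 0)

/-- The condition `D'(u_n)`, relative to the sequence `t_n` of `D₂(u_n)`. -/
def CondD' (P : Measure Ω) (X : ℕ → Ω → EReal) (u : ℕ → ℝ) (t : ℕ → ℕ) : Prop :=
  ∃ k : ℕ → ℕ, Tendsto k atTop atTop ∧
    (fun n : ℕ => (k n : ℝ) * (t n : ℝ)) =o[atTop] (fun n : ℕ => (n : ℝ)) ∧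
    Tendsto (fun n : ℕ => (n : ℝ) * ∑ j ∈ Finset.Icc 1 (n / k n),
      P.real {w | (u n : EReal) < X 0 w ∧ (u n : EReal) < X j w}) atTop (𝓝 0)

/-- `H` is a non-degenerate distribution function with `H 0 = 0`. -/
structure IsNondegenerateDF (H : ℝ → ℝ) : Prop where
  mono : Monotone H
  right_cont : ∀ s, ContinuousWithinAt H (Ici s) s
  atBot : Tendsto H atBot (𝓝 0)
  atTop : Tendsto H atTop (𝓝 1)
  nondegenerate : ∃ s, 0 < H s ∧ H s < 1
  zero : H 0 = 0

/-- `M_n` has the extreme value law `H`. -/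
def HasEVL (P : Measure Ω) (X : ℕ → Ω → EReal) (H : ℝ → ℝ) : Prop :=
  IsNondegenerateDF H ∧ ∀ τ > 0, ∃ u : ℕ → ℝ, IsNormalizing P X τ u ∧
    Tendsto (fun n => P.real {w | partialMax X n w ≤ (u n : EReal)}) atTop (𝓝 (1 - H τ))

/-- The standard exponential distribution function. -/
def stdExpDF (τ : ℝ) : ℝ := if 0 ≤ τ then 1 - Real.exp (-τ) else 0

/-- For all levels `u_n` with `n P(X_0 > u_n) → τ > 0`, both `D₂(u_n)` and `D'(u_n)` hold and
`P(M_n ≤ u_n) → e^{-τ}`; and `M_n` has the standard exponential extreme value law. -/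
def ExponentialExtremes (P : Measure Ω) (X : ℕ → Ω → EReal) : Prop :=
  (∀ τ > 0, ∀ u : ℕ → ℝ, IsNormalizing P X τ u →
    (∃ (γ : ℕ → ℕ → ℝ) (t : ℕ → ℕ), CondD2 P X u γ t ∧ CondD' P X u t) ∧
    Tendsto (fun n => P.real {w | partialMax X n w ≤ (u n : EReal)}) atTop
      (𝓝 (Real.exp (-τ)))) ∧
  HasEVL P X stdExpDF

end Extremes

end

end RandomEVL

open RandomEVL

/-!
For a stationary process the maxima satisfy
`P(M_{ℓ+1} ≤ u) = P(M_ℓ ≤ u) - P(X₀ > u, X₁, …, X_ℓ ≤ u)`. By `D₂` and `D'` the last term is close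
to `P(X₀ > u) P(M_ℓ ≤ u)`, so that `P(M_n ≤ u_n)` is close to `(1 - P(X₀ > u_n)) ^ n`, which tends
to `e^{-τ}`.

The noise spreads the mass of a small ball about a point of the dense orbit over a ball about the
next one. Following the orbit, mass gets from any ball to any other, and by connectedness the
travel times can be made to agree: some power of the transition kernel dominates one fixed nonzero
measure (Doeblin's condition). Hence any two initial laws couple at a geometric rate, which gives
`D₂`. The same spreading makes the volume absolutely continuous with respect to the stationary
measure `μ`, with bounded density; so the transition densities with respect to `μ` are bounded,
`P(X₀ > u, X_j > u) ≤ C P(X₀ > u) ^ 2`, and this gives `D'`.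
-/

namespace RandomEVL

open ProbabilityTheory

section ExtremeValues

variable {Ω : Type*} {X : ℕ → Ω → EReal} {ℓ : ℕ} {v : EReal}

theorem blockMax_le_iff {s : ℕ} {w : Ω} :
    blockMax X s ℓ w ≤ v ↔ ∀ i ∈ Finset.Ico s (s + ℓ), X i w ≤ v := Finset.sup_le_iff

theorem partialMax_le_iff {w : Ω} : partialMax X ℓ w ≤ v ↔ ∀ i ∈ Finset.range ℓ, X i w ≤ v :=
  Finset.sup_le_iff

theorem partialMax_succ_le_iff {w : Ω} :
    partialMax X (ℓ + 1) w ≤ v ↔ X 0 w ≤ v ∧ blockMax X 1 ℓ w ≤ v := by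
  simp only [partialMax, blockMax, ← sup_le_iff, Finset.range_eq_Ico, Nat.add_comm ℓ 1,
    ← Finset.insert_Ico_succ_left_eq_Ico (Nat.lt_of_lt_of_le one_pos (Nat.le_add_right 1 ℓ)),
    Finset.sup_insert, Order.succ_eq_add_one, zero_add]

theorem partialMax_mono (w : Ω) : Monotone fun ℓ => partialMax X ℓ w :=
  fun _ _ h => Finset.sup_mono (Finset.range_mono h)

variable [MeasurableSpace Ω] {P : Measure Ω}

/-- The maxima of `X₁, …, X_ℓ` and of `X₀, …, X_{ℓ-1}` have the same law: the weak form of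
stationarity behind the renewal identity `IsMaxStationary.measureReal_partialMax_succ`. -/
def IsMaxStationary (P : Measure Ω) (X : ℕ → Ω → EReal) : Prop :=
  ∀ (v : EReal) (ℓ : ℕ), P.real {w | blockMax X 1 ℓ w ≤ v} = P.real {w | partialMax X ℓ w ≤ v}

theorem IsMaxStationary.measureReal_partialMax_succ [IsFiniteMeasure P] (h : IsMaxStationary P X)
    (hX : Measurable (X 0)) (v : EReal) (ℓ : ℕ) :
    P.real {w | partialMax X (ℓ + 1) w ≤ v} =
      P.real {w | partialMax X ℓ w ≤ v} - P.real {w | v < X 0 w ∧ blockMax X 1 ℓ w ≤ v} := by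
  have hsplit := measureReal_inter_add_sdiff (μ := P) (s := {w | blockMax X 1 ℓ w ≤ v})
    (measurableSet_lt (measurable_const (a := v)) hX)
  have hfirst : {w | blockMax X 1 ℓ w ≤ v} \ {w | v < X 0 w} =
      {w | partialMax X (ℓ + 1) w ≤ v} := by
    ext w
    simp only [Set.mem_sdiff, mem_ofPred_eq, not_lt, partialMax_succ_le_iff, and_comm]
  have hlast : {w | blockMax X 1 ℓ w ≤ v} ∩ {w | v < X 0 w} =
      {w | v < X 0 w ∧ blockMax X 1 ℓ w ≤ v} := inter_comm _ _
  rw [hfirst, hlast, h] at hsplit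
  linarith

theorem IsMaxStationary.measureReal_partialMax_le_add [IsFiniteMeasure P]
    (h : IsMaxStationary P X) (hX : Measurable (X 0)) (v : EReal) (ℓ k : ℕ) :
    P.real {w | partialMax X ℓ w ≤ v} ≤
      P.real {w | partialMax X (ℓ + k) w ≤ v} + k * P.real {w | v < X 0 w} := by
  induction k with
  | zero => simp
  | succ k ih =>
    have hexc : P.real {w | v < X 0 w ∧ blockMax X 1 (ℓ + k) w ≤ v} ≤ P.real {w | v < X 0 w} :=
      measureReal_mono fun _ hw => hw.1
    rw [← add_assoc, h.measureReal_partialMax_succ hX v (ℓ + k)]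
    push_cast
    linarith

theorem measureReal_blockMax_le_shift [IsFiniteMeasure P] (X : ℕ → Ω → EReal) (v : EReal)
    (ℓ t : ℕ) :
    P.real {w | v < X 0 w ∧ blockMax X 1 ℓ w ≤ v} ≤
      P.real {w | v < X 0 w ∧ blockMax X (t + 1) (ℓ - t) w ≤ v} := by
  refine measureReal_mono fun w hw => ⟨hw.1, blockMax_le_iff.2 fun i hi => ?_⟩
  exact blockMax_le_iff.1 hw.2 i (by simp only [Finset.mem_Ico] at hi ⊢; omega)

theorem measureReal_blockMax_shift_le_add [IsFiniteMeasure P] (X : ℕ → Ω → EReal) (v : EReal)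
    (ℓ t : ℕ) :
    P.real {w | v < X 0 w ∧ blockMax X (t + 1) (ℓ - t) w ≤ v} ≤
      P.real {w | v < X 0 w ∧ blockMax X 1 ℓ w ≤ v} +
        ∑ j ∈ Finset.Icc 1 t, P.real {w | v < X 0 w ∧ v < X j w} := by
  have hcover : {w | v < X 0 w ∧ blockMax X (t + 1) (ℓ - t) w ≤ v} ⊆
      {w | v < X 0 w ∧ blockMax X 1 ℓ w ≤ v} ∪
        ⋃ j ∈ Finset.Icc 1 t, {w | v < X 0 w ∧ v < X j w} := by
    rintro w ⟨h0, hblock⟩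
    by_cases hnear : ∃ j ∈ Finset.Icc 1 t, v < X j w
    · obtain ⟨j, hj, hjv⟩ := hnear
      exact Or.inr (mem_iUnion₂.2 ⟨j, hj, h0, hjv⟩)
    · push Not at hnear
      refine Or.inl ⟨h0, blockMax_le_iff.2 fun i hi => ?_⟩
      by_cases hit : i ≤ t
      · exact hnear i (Finset.mem_Icc.2 ⟨(Finset.mem_Ico.1 hi).1, hit⟩)
      · exact blockMax_le_iff.1 hblock i (by simp only [Finset.mem_Ico] at hi ⊢; omega)
  calc _ ≤ _ := measureReal_mono hcover
    _ ≤ _ := measureReal_union_le _ _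
    _ ≤ _ := by gcongr; exact measureReal_biUnion_finset_le _ _

theorem IsMaxStationary.abs_measureReal_partialMax_succ_sub_le [IsFiniteMeasure P]
    (h : IsMaxStationary P X) (hX : Measurable (X 0)) (v : EReal) (ℓ t : ℕ) {γ : ℝ}
    (hmix : |P.real {w | v < X 0 w ∧ blockMax X (t + 1) (ℓ - t) w ≤ v} -
      P.real {w | v < X 0 w} * P.real {w | partialMax X (ℓ - t) w ≤ v}| ≤ γ) :
    |P.real {w | partialMax X (ℓ + 1) w ≤ v} -
      (1 - P.real {w | v < X 0 w}) * P.real {w | partialMax X ℓ w ≤ v}| ≤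
      ∑ j ∈ Finset.Icc 1 t, P.real {w | v < X 0 w ∧ v < X j w} + γ +
        t * P.real {w | v < X 0 w} ^ 2 := by
  have hshift := measureReal_blockMax_le_shift (P := P) X v ℓ t
  have hshift' := measureReal_blockMax_shift_le_add (P := P) X v ℓ t
  have hlong : P.real {w | partialMax X ℓ w ≤ v} ≤ P.real {w | partialMax X (ℓ - t) w ≤ v} :=
    measureReal_mono fun w hw => (partialMax_mono w (Nat.sub_le ℓ t)).trans hw
  have hshort : P.real {w | partialMax X (ℓ - t) w ≤ v} ≤
      P.real {w | partialMax X ℓ w ≤ v} + t * P.real {w | v < X 0 w} := by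
    refine (h.measureReal_partialMax_le_add hX v (ℓ - t) t).trans ?_
    gcongr ?_ + _
    exact measureReal_mono fun w hw => (partialMax_mono w le_tsub_add).trans hw
  rw [h.measureReal_partialMax_succ hX v ℓ]
  have hp : 0 ≤ P.real {w | v < X 0 w} := measureReal_nonneg
  rw [abs_le] at hmix ⊢
  constructor <;> nlinarith

theorem abs_sub_pow_le_of_abs_succ_sub_le {a : ℕ → ℝ} {p δ : ℝ} (hp0 : 0 ≤ p) (hp1 : p ≤ 1)
    (ha0 : a 0 = 1) (ha : ∀ n, |a (n + 1) - (1 - p) * a n| ≤ δ) (n : ℕ) :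
    |a n - (1 - p) ^ n| ≤ n * δ := by
  induction n with
  | zero => simp [ha0]
  | succ n ih =>
    have hcontr : |(1 - p) * (a n - (1 - p) ^ n)| ≤ |a n - (1 - p) ^ n| := by
      rw [abs_mul, abs_of_nonneg (by linarith)]
      exact mul_le_of_le_one_left (abs_nonneg _) (by linarith)
    calc |a (n + 1) - (1 - p) ^ (n + 1)|
        = |(a (n + 1) - (1 - p) * a n) + (1 - p) * (a n - (1 - p) ^ n)| := by ring_nf
      _ ≤ δ + n * δ := (abs_add_le _ _).trans (add_le_add (ha n) (hcontr.trans ih))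
      _ = (n + 1 : ℕ) * δ := by push_cast; ring

theorem abs_measureReal_partialMax_sub_pow_le [IsProbabilityMeasure P] (h : IsMaxStationary P X)
    (hX : Measurable (X 0)) {u : ℕ → ℝ} {γ : ℕ → ℕ → ℝ} {t : ℕ → ℕ} (hD : CondD2 P X u γ t)
    (n s : ℕ) (hs : t n ≤ s) :
    |P.real {w | partialMax X n w ≤ (u n : EReal)} -
      (1 - P.real {w | (u n : EReal) < X 0 w}) ^ n| ≤
      n * (∑ j ∈ Finset.Icc 1 s, P.real {w | (u n : EReal) < X 0 w ∧ (u n : EReal) < X j w} +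
        γ n (t n) + t n * P.real {w | (u n : EReal) < X 0 w} ^ 2) := by
  refine abs_sub_pow_le_of_abs_succ_sub_le
    (a := fun ℓ => P.real {w | partialMax X ℓ w ≤ (u n : EReal)}) measureReal_nonneg
    measureReal_le_one (by simp [partialMax]) (fun ℓ => ?_) n
  refine (h.abs_measureReal_partialMax_succ_sub_le hX (u n) ℓ (t n)
    (hD.bound (ℓ - t n) (t n + 1) n)).trans ?_
  have hγ : γ n (t n + 1) ≤ γ n (t n) := hD.antitone n (Nat.le_succ _)
  have hsum := Finset.sum_le_sum_of_subset_of_nonneg (Finset.Icc_subset_Icc_right (a := 1) hs)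
    fun j _ _ => measureReal_nonneg (μ := P)
      (s := {w | (u n : EReal) < X 0 w ∧ (u n : EReal) < X j w})
  gcongr

theorem tendsto_measureReal_partialMax [IsProbabilityMeasure P] (h : IsMaxStationary P X)
    (hX : Measurable (X 0)) {τ : ℝ} {u : ℕ → ℝ} {γ : ℕ → ℕ → ℝ} {t : ℕ → ℕ}
    (hu : IsNormalizing P X τ u) (hD : CondD2 P X u γ t) (hD' : CondD' P X u t) :
    Tendsto (fun n => P.real {w | partialMax X n w ≤ (u n : EReal)}) atTop
      (𝓝 (Real.exp (-τ))) := by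
  obtain ⟨k, hk, hkt, hsum⟩ := hD'
  have hpow : Tendsto (fun n : ℕ => (1 - P.real {w | (u n : EReal) < X 0 w}) ^ n) atTop
      (𝓝 (Real.exp (-τ))) := by
    have : Tendsto (fun n : ℕ => (n : ℝ) * -P.real {w | (u n : EReal) < X 0 w}) atTop
        (𝓝 (-τ)) := by simpa only [mul_neg] using hu.neg
    simpa only [← sub_eq_add_neg] using Real.tendsto_one_add_pow_exp_of_tendsto this
  have hgap : ∀ᶠ n in atTop, t n ≤ n / k n := by
    filter_upwards [hkt.bound one_pos, hk.eventually_gt_atTop 0] with n hn hkn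
    rw [Nat.le_div_iff_mul_le hkn, mul_comm]
    simp only [norm_mul, RCLike.norm_natCast, one_mul] at hn
    exact_mod_cast hn
  have herr := (hsum.add hD.tendsto).add (hD.isLittleO.tendsto_div_nhds_zero.mul (hu.pow 2))
  rw [zero_mul, add_zero, add_zero] at herr
  have hdiff : Tendsto (fun n => P.real {w | partialMax X n w ≤ (u n : EReal)} -
      (1 - P.real {w | (u n : EReal) < X 0 w}) ^ n) atTop (𝓝 0) := by
    refine squeeze_zero_norm' ?_ herr
    filter_upwards [hgap, eventually_gt_atTop 0] with n hn hn0
    refine (abs_measureReal_partialMax_sub_pow_le h hX hD n _ hn).trans_eq ?_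
    field_simp
  simpa only [sub_add_cancel, zero_add] using hdiff.add hpow

theorem condD2_of_mixing {τ : ℝ} {u : ℕ → ℝ} {r : ℕ → ℝ} {t : ℕ → ℕ}
    (hu : IsNormalizing P X τ u) (hr : Antitone r) (hr0 : Tendsto r atTop (𝓝 0))
    (ht : Tendsto t atTop atTop) (hto : (fun n => (t n : ℝ)) =o[atTop] fun n : ℕ => (n : ℝ))
    (hmix : ∀ (v : EReal) (ℓ s : ℕ), |P.real {w | v < X 0 w ∧ blockMax X s ℓ w ≤ v} -
      P.real {w | v < X 0 w} * P.real {w | partialMax X ℓ w ≤ v}| ≤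
        P.real {w | v < X 0 w} * r s) :
    CondD2 P X u (fun n s => P.real {w | (u n : EReal) < X 0 w} * r s) t where
  bound ℓ s n := hmix (u n) ℓ s
  antitone _ _ _ hs := mul_le_mul_of_nonneg_left (hr hs) measureReal_nonneg
  isLittleO := hto
  tendsto := by
    simpa only [mul_zero, mul_assoc, Function.comp_apply] using Tendsto.mul hu (hr0.comp ht)

theorem condD'_of_correlation_le {τ C : ℝ} {u : ℕ → ℝ} {t : ℕ → ℕ}
    (hu : IsNormalizing P X τ u) (ht : Tendsto t atTop atTop)
    (hto : (fun n => (t n : ℝ) * (t n : ℝ)) =o[atTop] fun n : ℕ => (n : ℝ)) (hC : 0 ≤ C)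
    (hcorr : ∀ (v : EReal) (j : ℕ), 1 ≤ j →
      P.real {w | v < X 0 w ∧ v < X j w} ≤ C * P.real {w | v < X 0 w} ^ 2) :
    CondD' P X u t := by
  refine ⟨t, ht, hto, ?_⟩
  have hinv : Tendsto (fun n => ((t n : ℝ))⁻¹) atTop (𝓝 0) :=
    tendsto_inv_atTop_zero.comp (tendsto_natCast_atTop_atTop.comp ht)
  have hlim := ((hu.mul hu).mul hinv).const_mul C
  rw [mul_zero, mul_zero] at hlim
  refine squeeze_zero (fun n => by positivity) (fun n => ?_) hlim
  set p := P.real {w | (u n : EReal) < X 0 w}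
  calc (n : ℝ) * ∑ j ∈ Finset.Icc 1 (n / t n),
        P.real {w | (u n : EReal) < X 0 w ∧ (u n : EReal) < X j w}
      ≤ n * ∑ j ∈ Finset.Icc 1 (n / t n), C * p ^ 2 := by
        gcongr with j hj
        exact hcorr _ _ (Finset.mem_Icc.1 hj).1
    _ = n * ((n / t n : ℕ) * (C * p ^ 2)) := by
        rw [Finset.sum_const, nsmul_eq_mul, Nat.card_Icc, Nat.add_sub_cancel]
    _ ≤ n * ((n / t n) * (C * p ^ 2)) := by gcongr; exact Nat.cast_div_le
    _ = C * (n * p * (n * p) * (t n : ℝ)⁻¹) := by ring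

theorem tendsto_floor_log_atTop : Tendsto (fun n : ℕ => ⌊Real.log n⌋₊) atTop atTop :=
  tendsto_nat_floor_atTop.comp (Real.tendsto_log_atTop.comp tendsto_natCast_atTop_atTop)

theorem isLittleO_floor_log_pow (k : ℕ) :
    (fun n : ℕ => (⌊Real.log n⌋₊ : ℝ) ^ k) =o[atTop] fun n : ℕ => (n : ℝ) := by
  refine Asymptotics.IsBigO.trans_isLittleO (.of_bound 1 (Eventually.of_forall fun n => ?_))
    ((Real.isLittleO_pow_log_id_atTop (n := k)).comp_tendsto tendsto_natCast_atTop_atTop)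
  have hlog : 0 ≤ Real.log n := Real.log_natCast_nonneg n
  simp only [Function.comp_apply, norm_pow, RCLike.norm_natCast, one_mul,
    Real.norm_of_nonneg hlog]
  gcongr
  exact Nat.floor_le hlog

theorem stdExpDF_eq_one_sub_exp_neg_max : stdExpDF = fun s => 1 - Real.exp (-(max s 0)) := by
  funext s
  rcases le_or_gt 0 s with hs | hs
  · rw [stdExpDF, if_pos hs, max_eq_left hs]
  · rw [stdExpDF, if_neg hs.not_ge, max_eq_right hs.le, neg_zero, Real.exp_zero, sub_self]

theorem isNondegenerateDF_stdExpDF : IsNondegenerateDF stdExpDF where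
  mono a b hab := by
    simp only [stdExpDF_eq_one_sub_exp_neg_max]
    gcongr
  right_cont s := by
    rw [stdExpDF_eq_one_sub_exp_neg_max]
    exact Continuous.continuousWithinAt (by fun_prop)
  atBot := tendsto_const_nhds.congr' <| (eventually_lt_atBot 0).mono fun s hs => by
    rw [stdExpDF, if_neg hs.not_ge]
  atTop := by
    have hlim : Tendsto (fun s : ℝ => 1 - Real.exp (-s)) atTop (𝓝 1) := by
      simpa only [sub_zero] using Real.tendsto_exp_neg_atTop_nhds_zero.const_sub 1
    refine hlim.congr' <| (eventually_ge_atTop 0).mono fun s hs => ?_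
    rw [stdExpDF, if_pos hs]
  nondegenerate := ⟨1, by simp [stdExpDF], by simp [stdExpDF, Real.exp_pos]⟩
  zero := by simp [stdExpDF]

theorem measure_lt_pos_of_lt_essSup {f : Ω → EReal} (hv : v < essSup f P) :
    0 < P {w | v < f w} := by
  contrapose! hv
  exact essSup_le_of_ae_le v (ae_iff.2 (by simpa only [not_le] using nonpos_iff_eq_zero.1 hv))

theorem exists_measure_lt_eq {f : Ω → EReal} (hbot : essSup f P ≠ ⊥)
    (hcont : ∀ᶠ v in 𝓝 (essSup f P), ContinuousAt (fun v => P {w | v < f w}) v) :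
    ∃ c > 0, ∀ y, 0 < y → y < c → ∃ u : ℝ, P {w | (u : EReal) < f w} = y := by
  obtain ⟨a, ha, hcont⟩ := exists_Ioc_subset_of_mem_nhds hcont ⟨⊥, bot_lt_iff_ne_bot.2 hbot⟩
  obtain ⟨v, hav, hv⟩ := exists_between ha
  refine ⟨P {w | v < f w}, measure_lt_pos_of_lt_essSup hv, fun y hy0 hy => ?_⟩
  have hivt := intermediate_value_Icc' (f := fun v => P {w | v < f w}) hv.le
    (fun w hw => ContinuousAt.continuousWithinAt (hcont ⟨hav.trans_le hw.1, hw.2⟩))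
  rw [meas_essSup_lt] at hivt
  obtain ⟨u, ⟨hvu, huess⟩, rfl⟩ := hivt ⟨zero_le, hy.le⟩
  have hu_lt : u < essSup f P := huess.lt_of_ne fun h => hy0.ne' (h ▸ meas_essSup_lt)
  exact ⟨u.toReal, by rw [EReal.coe_toReal hu_lt.ne_top (hav.trans_le hvu).ne_bot]⟩

theorem exists_isNormalizing (hbot : essSup (X 0) P ≠ ⊥)
    (hcont : ∀ᶠ v in 𝓝 (essSup (X 0) P), ContinuousAt (fun v => P {w | v < X 0 w}) v)
    {τ : ℝ} (hτ : 0 < τ) : ∃ u, IsNormalizing P X τ u := by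
  obtain ⟨c, hc, hlevel⟩ := exists_measure_lt_eq hbot hcont
  have hsmall : Tendsto (fun n : ℕ => ENNReal.ofReal (τ / n)) atTop (𝓝 0) := by
    simpa only [ENNReal.ofReal_zero] using
      ENNReal.tendsto_ofReal (tendsto_const_div_atTop_nhds_zero_nat τ)
  have hexists : ∀ᶠ n : ℕ in atTop, ∃ u : ℝ,
      P {w | (u : EReal) < X 0 w} = ENNReal.ofReal (τ / n) := by
    filter_upwards [hsmall.eventually_lt_const hc, eventually_gt_atTop 0] with n hn hn0
    exact hlevel _ (ENNReal.ofReal_pos.2 (by positivity)) hn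
  obtain ⟨u, hu⟩ := hexists.choice
  refine ⟨u, tendsto_const_nhds.congr' ?_⟩
  filter_upwards [hu, eventually_gt_atTop 0] with n hn hn0
  rw [measureReal_def, hn, ENNReal.toReal_ofReal (by positivity)]
  field_simp

theorem exponentialExtremes_of_mixing [IsProbabilityMeasure P] {r : ℕ → ℝ} {C : ℝ}
    (hX : Measurable (X 0)) (hstat : IsMaxStationary P X) (hbot : essSup (X 0) P ≠ ⊥)
    (hcont : ∀ᶠ v in 𝓝 (essSup (X 0) P), ContinuousAt (fun v => P {w | v < X 0 w}) v)
    (hr : Antitone r) (hr0 : Tendsto r atTop (𝓝 0))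
    (hmix : ∀ (v : EReal) (ℓ s : ℕ), |P.real {w | v < X 0 w ∧ blockMax X s ℓ w ≤ v} -
      P.real {w | v < X 0 w} * P.real {w | partialMax X ℓ w ≤ v}| ≤
        P.real {w | v < X 0 w} * r s)
    (hC : 0 ≤ C) (hcorr : ∀ (v : EReal) (j : ℕ), 1 ≤ j →
      P.real {w | v < X 0 w ∧ v < X j w} ≤ C * P.real {w | v < X 0 w} ^ 2) :
    ExponentialExtremes P X := by
  have hD2 {τ : ℝ} {u : ℕ → ℝ} (hu : IsNormalizing P X τ u) :=
    condD2_of_mixing hu hr hr0 tendsto_floor_log_atTop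
      (by simpa only [pow_one] using isLittleO_floor_log_pow 1) hmix
  have hD' {τ : ℝ} {u : ℕ → ℝ} (hu : IsNormalizing P X τ u) :=
    condD'_of_correlation_le hu tendsto_floor_log_atTop
      (by simpa only [sq] using isLittleO_floor_log_pow 2) hC hcorr
  have hlim {τ : ℝ} {u : ℕ → ℝ} (hu : IsNormalizing P X τ u) :=
    tendsto_measureReal_partialMax hstat hX hu (hD2 hu) (hD' hu)
  refine ⟨fun τ _ u hu => ⟨⟨_, _, hD2 hu, hD' hu⟩, hlim hu⟩, isNondegenerateDF_stdExpDF,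
    fun τ hτ => ?_⟩
  obtain ⟨u, hu⟩ := exists_isNormalizing hbot hcont hτ
  exact ⟨u, hu, by simpa only [stdExpDF, hτ.le, if_true, sub_sub_cancel] using hlim hu⟩

end ExtremeValues

section Kernels

variable {M M' : Type*} [MeasurableSpace M] [MeasurableSpace M']

theorem comp_mono {κ : Kernel M M'} {μ ν : Measure M} (h : μ ≤ ν) : κ ∘ₘ μ ≤ κ ∘ₘ ν := by
  refine Measure.le_iff.2 fun A hA => ?_
  rw [Measure.bind_apply hA κ.aemeasurable, Measure.bind_apply hA κ.aemeasurable]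
  exact lintegral_mono' h le_rfl

theorem smul_le_comp_of_ae_le {κ : Kernel M M'} {μ : Measure M} {ν : Measure M'}
    (h : ∀ᵐ x ∂μ, ν ≤ κ x) : μ univ • ν ≤ κ ∘ₘ μ := by
  refine Measure.le_iff.2 fun A hA => ?_
  rw [Measure.smul_apply, smul_eq_mul, Measure.bind_apply hA κ.aemeasurable, mul_comm,
    ← lintegral_const]
  exact lintegral_mono_ae (h.mono fun x hx => hx A)

theorem comp_le_smul_of_ae_le {κ : Kernel M M'} {μ : Measure M} {ν : Measure M'}
    (h : ∀ᵐ x ∂μ, κ x ≤ ν) : κ ∘ₘ μ ≤ μ univ • ν := by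
  refine Measure.le_iff.2 fun A hA => ?_
  rw [Measure.smul_apply, smul_eq_mul, Measure.bind_apply hA κ.aemeasurable, mul_comm,
    ← lintegral_const]
  exact lintegral_mono_ae (h.mono fun x hx => hx A)

variable {κ : Kernel M M} {μ : Measure M}

theorem pow_add_comp (m n : ℕ) : (κ ^ (m + n)) ∘ₘ μ = (κ ^ m) ∘ₘ ((κ ^ n) ∘ₘ μ) := by
  rw [Kernel.pow_add, Measure.comp_assoc]

theorem isMarkovKernel_pow [IsMarkovKernel κ] (n : ℕ) : IsMarkovKernel (κ ^ n) := by
  induction n with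
  | zero => exact inferInstanceAs (IsMarkovKernel Kernel.id)
  | succ n ih => exact inferInstanceAs (IsMarkovKernel ((κ ^ n) ∘ₖ κ))

theorem invariant_pow (h : κ.Invariant μ) (n : ℕ) : (κ ^ n).Invariant μ := by
  induction n with
  | zero => exact Measure.id_comp
  | succ n ih => exact ih.comp h

theorem invariant_of_isStationaryMeasure (h : IsStationaryMeasure κ μ) : κ.Invariant μ :=
  Measure.ext fun A hA => (Measure.bind_apply hA κ.aemeasurable).trans (h A hA)

theorem absolutelyContinuous_of_invariant {m : Measure M} (h : κ.Invariant μ)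
    (hκ : ∀ᵐ x ∂μ, κ x ≪ m) : μ ≪ m := by
  rw [← h.def]
  refine Measure.AbsolutelyContinuous.mk fun A hA hmA => ?_
  rw [Measure.bind_apply hA κ.aemeasurable, lintegral_eq_zero_iff (κ.measurable_coe hA)]
  exact hκ.mono fun x hx => hx hmA

theorem exists_comp_eq_smul_add [IsMarkovKernel κ] [IsFiniteMeasure μ] {ν : Measure M}
    (h : ∀ᵐ x ∂μ, ν ≤ κ x) : ∃ ξ : Measure M, IsFiniteMeasure ξ ∧
      κ ∘ₘ μ = μ univ • ν + ξ ∧ ξ univ = (1 - ν univ) * μ univ := by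
  have hle := smul_le_comp_of_ae_le h
  have := isFiniteMeasure_of_le _ hle
  have hsum : κ ∘ₘ μ = μ univ • ν + (κ ∘ₘ μ - μ univ • ν) := by
    rw [add_comm, Measure.sub_add_cancel_of_le hle]
  refine ⟨κ ∘ₘ μ - μ univ • ν, inferInstance, hsum, ?_⟩
  rw [Measure.sub_apply .univ hle, Measure.comp_apply_univ, Measure.smul_apply, smul_eq_mul,
    ENNReal.sub_mul fun _ _ => measure_ne_top μ univ, one_mul, mul_comm]

theorem exists_pow_comp_le_add [IsMarkovKernel κ] {ν : Measure M} (hκ : κ ∘ₘ μ ≪ μ)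
    (hν : ∀ᵐ x ∂μ, ν ≤ κ x) (k : ℕ) {α β : Measure M} [IsFiniteMeasure α] [IsFiniteMeasure β]
    (hα : α ≪ μ) (hβ : β ≪ μ) (hαβ : α univ = β univ) :
    ∃ ε : Measure M, (κ ^ k) ∘ₘ α ≤ (κ ^ k) ∘ₘ β + ε ∧ ε univ = (1 - ν univ) ^ k * α univ := by
  induction k generalizing α β with
  | zero =>
    refine ⟨α, ?_, by rw [pow_zero, one_mul]⟩
    exact (Measure.id_comp (μ := α)).le.trans (Measure.le_add_left le_rfl)
  | succ k ih =>
    -- The images of `α` and `β` share the part `α univ • ν`, so only their remainders differ.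
    obtain ⟨α', hα'fin, hα'sum, hα'univ⟩ := exists_comp_eq_smul_add (hα.ae_le hν)
    obtain ⟨β', hβ'fin, hβ'sum, hβ'univ⟩ := exists_comp_eq_smul_add (hβ.ae_le hν)
    have hac {ξ ξ' : Measure M} {c : ℝ≥0∞} (hξ : ξ ≪ μ) (hsum : κ ∘ₘ ξ = c • ν + ξ') : ξ' ≪ μ :=
      (Measure.absolutelyContinuous_of_le (hsum ▸ Measure.le_add_left le_rfl)).trans
        ((hξ.comp_right κ).trans hκ)
    obtain ⟨ε, hε, hεuniv⟩ := ih (hac hα hα'sum) (hac hβ hβ'sum) (by rw [hα'univ, hβ'univ, hαβ])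
    refine ⟨ε, ?_, by rw [hεuniv, hα'univ, pow_succ, mul_assoc]⟩
    rw [pow_add_comp, pow_add_comp, pow_one, hα'sum, hβ'sum, hαβ, Measure.comp_add,
      Measure.comp_add, add_assoc]
    gcongr

theorem lintegral_pow_comp_le_add [IsMarkovKernel κ] {ν : Measure M} {N : ℕ}
    (hμ : κ.Invariant μ) (hν : ∀ᵐ x ∂μ, ν ≤ (κ ^ N) x) (s : ℕ) {α β : Measure M}
    [IsFiniteMeasure α] [IsFiniteMeasure β] (hα : α ≪ μ) (hβ : β ≪ μ) (hαβ : α univ = β univ)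
    {g : M → ℝ≥0∞} (hg : ∀ x, g x ≤ 1) :
    ∫⁻ x, g x ∂((κ ^ s) ∘ₘ α) ≤
      ∫⁻ x, g x ∂((κ ^ s) ∘ₘ β) + (1 - ν univ) ^ (s / N) * α univ := by
  have hmarkov := isMarkovKernel_pow (κ := κ)
  have hac {ξ : Measure M} (hξ : ξ ≪ μ) : (κ ^ (s % N)) ∘ₘ ξ ≪ μ :=
    (hξ.comp_right _).trans (invariant_pow hμ _).def.absolutelyContinuous
  have hsplit (ξ : Measure M) :
      (κ ^ s) ∘ₘ ξ = ((κ ^ N) ^ (s / N)) ∘ₘ ((κ ^ (s % N)) ∘ₘ ξ) := by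
    rw [← pow_mul, ← pow_add_comp, Nat.div_add_mod]
  obtain ⟨ε, hε, hεuniv⟩ := exists_pow_comp_le_add
    (invariant_pow hμ N).def.absolutelyContinuous hν (s / N) (hac hα) (hac hβ)
    (by simp only [Measure.comp_apply_univ, hαβ])
  rw [Measure.comp_apply_univ] at hεuniv
  calc ∫⁻ x, g x ∂((κ ^ s) ∘ₘ α)
      ≤ ∫⁻ x, g x ∂((κ ^ s) ∘ₘ β + ε) := by
        rw [hsplit, hsplit]; exact lintegral_mono' hε le_rfl
    _ = ∫⁻ x, g x ∂((κ ^ s) ∘ₘ β) + ∫⁻ x, g x ∂ε := lintegral_add_measure _ _ _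
    _ ≤ ∫⁻ x, g x ∂((κ ^ s) ∘ₘ β) + ∫⁻ _, 1 ∂ε := by gcongr; exact hg _
    _ = _ := by rw [lintegral_one, hεuniv]

end Kernels

section Chains

variable {M Ω : Type*} [MeasurableSpace M]

/-- The probability that the first `ℓ` points of the chain with kernel `κ`, the starting point
included, avoid `A`, as a function of the starting point. -/
noncomputable def avoidance (κ : Kernel M M) (A : Set M) : ℕ → M → ℝ≥0∞
  | 0 => fun _ => 1
  | ℓ + 1 => Aᶜ.indicator fun x => ∫⁻ y, avoidance κ A ℓ y ∂κ x

theorem measurable_avoidance {κ : Kernel M M} {A : Set M} (hA : MeasurableSet A) (ℓ : ℕ) :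
    Measurable (avoidance κ A ℓ) := by
  induction ℓ with
  | zero => exact measurable_const
  | succ ℓ ih => exact ih.lintegral_kernel.indicator hA.compl

theorem avoidance_le_one {κ : Kernel M M} [IsMarkovKernel κ] {A : Set M} {ℓ : ℕ} (x : M) :
    avoidance κ A ℓ x ≤ 1 := by
  induction ℓ generalizing x with
  | zero => exact le_rfl
  | succ ℓ ih =>
    refine (indicator_le_self _ _ x).trans ((lintegral_mono ih).trans_eq ?_)
    rw [lintegral_one, measure_univ]

/-- The σ-algebra generated by `Z₀, …, Z_n`. -/
abbrev history (Z : ℕ → Ω → M) (n : ℕ) : MeasurableSpace Ω :=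
  MeasurableSpace.comap (fun w (i : Fin (n + 1)) => Z i w) inferInstance

theorem history_mono (Z : ℕ → Ω → M) : Monotone (history Z) := fun n m h => by
  have hfactor : (fun w (i : Fin (n + 1)) => Z i w) =
      (fun (z : Fin (m + 1) → M) i => z (Fin.castLE (Nat.succ_le_succ h) i)) ∘
        fun w (i : Fin (m + 1)) => Z i w := rfl
  rw [history, hfactor, ← MeasurableSpace.comap_comp]
  exact MeasurableSpace.comap_mono (Measurable.comap_le (by fun_prop))

theorem measurableSet_history_preimage (Z : ℕ → Ω → M) (n : ℕ) {A : Set M}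
    (hA : MeasurableSet A) : MeasurableSet[history Z n] (Z n ⁻¹' A) :=
  ⟨(fun z => z (Fin.last n)) ⁻¹' A, hA.preimage (by fun_prop), rfl⟩

variable [MeasurableSpace Ω] {κ : Kernel M M} {μ : Measure M} {P : Measure Ω} {Z : ℕ → Ω → M}
  {S : Set Ω} {A : Set M} {n : ℕ}

namespace IsMarkovChain

theorem isProbabilityMeasure (h : IsMarkovChain κ μ P Z) : IsProbabilityMeasure μ :=
  have := h.prob
  h.initial ▸ Measure.isProbabilityMeasure_map (h.measurable 0).aemeasurable

theorem map_restrict_succ (h : IsMarkovChain κ μ P Z) (hS : MeasurableSet[history Z n] S) :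
    (P.restrict S).map (Z (n + 1)) = κ ∘ₘ (P.restrict S).map (Z n) := by
  obtain ⟨B, hB, rfl⟩ := hS
  ext A hA
  rw [Measure.map_apply (h.measurable _) hA, Measure.restrict_apply (h.measurable _ hA),
    inter_comm, Measure.bind_apply hA κ.aemeasurable,
    lintegral_map (κ.measurable_coe hA) (h.measurable n)]
  exact h.step n B A hB hA

theorem map_restrict_add (h : IsMarkovChain κ μ P Z) (hS : MeasurableSet[history Z n] S)
    (k : ℕ) : (P.restrict S).map (Z (n + k)) = (κ ^ k) ∘ₘ (P.restrict S).map (Z n) := by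
  induction k with
  | zero => exact Measure.id_comp.symm
  | succ k ih =>
    rw [← add_assoc, h.map_restrict_succ (history_mono Z (Nat.le_add_right n k) _ hS), ih,
      add_comm k 1, pow_add_comp, pow_one]

theorem map_eq (h : IsMarkovChain κ μ P Z) (hμ : κ.Invariant μ) (n : ℕ) : P.map (Z n) = μ := by
  have hpow := h.map_restrict_add (n := 0) (S := univ) .univ n
  rwa [Measure.restrict_univ, zero_add, h.initial, (invariant_pow hμ n).def] at hpow

theorem map_restrict_preimage_zero (h : IsMarkovChain κ μ P Z) (hA : MeasurableSet A) (s : ℕ) :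
    (P.restrict (Z 0 ⁻¹' A)).map (Z s) = (κ ^ s) ∘ₘ μ.restrict A := by
  have hpow := h.map_restrict_add (measurableSet_history_preimage Z 0 hA) s
  rwa [zero_add, ← Measure.restrict_map (h.measurable 0) hA, h.initial] at hpow

theorem measure_inter_forall_notMem (h : IsMarkovChain κ μ P Z) (hA : MeasurableSet A) (ℓ : ℕ)
    (hS : MeasurableSet[history Z n] S) :
    P (S ∩ {w | ∀ i ∈ Finset.Ico n (n + ℓ), Z i w ∉ A}) =
      ∫⁻ x, avoidance κ A ℓ x ∂(P.restrict S).map (Z n) := by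
  induction ℓ generalizing n S with
  | zero => simp [avoidance, (h.measurable n)]
  | succ ℓ ih =>
    have hS' : MeasurableSet[history Z n] (S ∩ Z n ⁻¹' Aᶜ) :=
      hS.inter (measurableSet_history_preimage Z n hA.compl)
    have hset : S ∩ {w | ∀ i ∈ Finset.Ico n (n + (ℓ + 1)), Z i w ∉ A} =
        (S ∩ Z n ⁻¹' Aᶜ) ∩ {w | ∀ i ∈ Finset.Ico (n + 1) (n + 1 + ℓ), Z i w ∉ A} := by
      rw [Nat.add_right_comm n 1 ℓ, ← add_assoc, inter_assoc,
        ← Finset.insert_Ico_add_one_left_eq_Ico (by omega : n < n + ℓ + 1)]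
      simp only [Finset.forall_mem_insert, ofPred_and]
      rfl
    rw [hset, ih (history_mono Z n.le_succ _ hS'), h.map_restrict_succ hS',
      Measure.lintegral_bind κ.aemeasurable (measurable_avoidance hA ℓ).aemeasurable,
      inter_comm S, ← Measure.restrict_restrict (h.measurable n hA.compl),
      ← Measure.restrict_map (h.measurable n) hA.compl, ← lintegral_indicator hA.compl]
    rfl

theorem measureReal_mem (h : IsMarkovChain κ μ P Z) (hA : MeasurableSet A) :
    P.real {w | Z 0 w ∈ A} = μ.real A := by
  rw [← h.initial, map_measureReal_apply (h.measurable 0) hA]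
  rfl

theorem measureReal_forall_notMem (h : IsMarkovChain κ μ P Z) (hμ : κ.Invariant μ)
    (hA : MeasurableSet A) (s ℓ : ℕ) :
    P.real {w | ∀ i ∈ Finset.Ico s (s + ℓ), Z i w ∉ A} =
      (∫⁻ x, avoidance κ A ℓ x ∂μ).toReal := by
  have hmeas := h.measure_inter_forall_notMem hA ℓ (n := s) (S := univ) .univ
  rw [univ_inter, Measure.restrict_univ, h.map_eq hμ] at hmeas
  rw [measureReal_def, hmeas]

theorem abs_measureReal_forall_notMem_sub_le [IsMarkovKernel κ]
    (h : IsMarkovChain κ μ P Z) (hμ : κ.Invariant μ) {ν : Measure M} {N : ℕ}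
    (hν : ∀ᵐ x ∂μ, ν ≤ (κ ^ N) x) (hA : MeasurableSet A) (s ℓ : ℕ) :
    |P.real {w | Z 0 w ∈ A ∧ ∀ i ∈ Finset.Ico s (s + ℓ), Z i w ∉ A} -
      μ.real A * P.real {w | ∀ i ∈ Finset.range ℓ, Z i w ∉ A}| ≤
        μ.real A * (1 - ν univ).toReal ^ (s / N) := by
  have := h.prob
  have := h.isProbabilityMeasure
  set g := avoidance κ A ℓ
  have hmass : μ.restrict A univ = (μ A • μ) univ := by simp
  have hfin : IsFiniteMeasure (μ A • μ) := μ.smul_finite (measure_ne_top μ A)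
  have hexc : ∫⁻ x, g x ∂((κ ^ s) ∘ₘ μ.restrict A) =
      P {w | Z 0 w ∈ A ∧ ∀ i ∈ Finset.Ico s (s + ℓ), Z i w ∉ A} := by
    rw [← h.map_restrict_preimage_zero hA s, ← h.measure_inter_forall_notMem hA ℓ
      (history_mono Z (Nat.zero_le s) _ (measurableSet_history_preimage Z 0 hA))]
    rfl
  have hprod : ∫⁻ x, g x ∂((κ ^ s) ∘ₘ (μ A • μ)) = μ A * ∫⁻ x, g x ∂μ := by
    rw [Measure.comp_smul, (invariant_pow hμ s).def, lintegral_smul_measure, smul_eq_mul]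
  have hupper := lintegral_pow_comp_le_add hμ hν s Measure.restrict_le_self.absolutelyContinuous
    Measure.smul_absolutelyContinuous hmass (avoidance_le_one (κ := κ) (A := A) (ℓ := ℓ))
  have hlower := lintegral_pow_comp_le_add hμ hν s Measure.smul_absolutelyContinuous
    Measure.restrict_le_self.absolutelyContinuous hmass.symm
    (avoidance_le_one (κ := κ) (A := A) (ℓ := ℓ))
  rw [← hmass] at hlower
  rw [hexc, hprod, Measure.restrict_apply_univ] at hupper hlower
  have hg : ∫⁻ x, g x ∂μ ≠ ⊤ :=
    ((lintegral_mono avoidance_le_one).trans_lt (by simp)).ne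
  have havoid := h.measureReal_forall_notMem hμ hA 0 ℓ
  rw [zero_add, ← Finset.range_eq_Ico] at havoid
  rw [havoid, mul_comm (μ.real A) (_ ^ _), ← ENNReal.toReal_pow]
  simp only [measureReal_def, ← ENNReal.toReal_mul]
  have hprod_ne : μ A * ∫⁻ x, g x ∂μ ≠ ⊤ := ENNReal.mul_ne_top (measure_ne_top μ A) hg
  have hrate_ne : (1 - ν univ) ^ (s / N) * μ A ≠ ⊤ :=
    ENNReal.mul_ne_top (ENNReal.pow_ne_top (by simp)) (measure_ne_top μ A)
  rw [abs_sub_le_iff]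
  exact ⟨sub_le_iff_le_add'.2 (ENNReal.toReal_le_add hupper hprod_ne hrate_ne),
    sub_le_iff_le_add'.2 (ENNReal.toReal_le_add hlower (measure_ne_top _ _) hrate_ne)⟩

theorem measureReal_mem_mem_le (h : IsMarkovChain κ μ P Z) (hμ : κ.Invariant μ)
    {C : ℝ≥0} (hC : ∀ᵐ x ∂μ, κ x ≤ C • μ) (hA : MeasurableSet A) {j : ℕ}
    (hj : 1 ≤ j) : P.real {w | Z 0 w ∈ A ∧ Z j w ∈ A} ≤ C * μ.real A ^ 2 := by
  have := h.isProbabilityMeasure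
  obtain ⟨n, rfl⟩ := Nat.exists_eq_add_of_le' hj
  have hac : (κ ^ n) ∘ₘ μ.restrict A ≪ μ :=
    (Measure.restrict_le_self.absolutelyContinuous.comp_right _).trans
      (invariant_pow hμ n).def.absolutelyContinuous
  have hlaw : (P.restrict (Z 0 ⁻¹' A)).map (Z (n + 1)) ≤
      (P.restrict (Z 0 ⁻¹' A)).map (Z n) univ • C • μ := by
    rw [h.map_restrict_succ (history_mono Z n.zero_le _ (measurableSet_history_preimage Z 0 hA)),
      h.map_restrict_preimage_zero hA]
    exact comp_le_smul_of_ae_le (hac.ae_le hC)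
  have hevent : P {w | Z 0 w ∈ A ∧ Z (n + 1) w ∈ A} ≤ P (Z 0 ⁻¹' A) * (C * μ A) := by
    have hle := hlaw A
    rwa [Measure.map_apply (h.measurable _) hA, Measure.restrict_apply (h.measurable _ hA),
      inter_comm, Measure.smul_apply, Measure.map_apply (h.measurable n) .univ, preimage_univ,
      Measure.restrict_apply_univ] at hle
  rw [← Measure.map_apply (h.measurable 0) hA, h.initial] at hevent
  refine (ENNReal.toReal_mono (by finiteness) hevent).trans_eq ?_
  rw [ENNReal.toReal_mul, ENNReal.toReal_mul, ENNReal.coe_toReal, ← measureReal_def]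
  ring

theorem isMaxStationary (h : IsMarkovChain κ μ P Z) (hμ : κ.Invariant μ) {φ : M → EReal}
    (hφ : Measurable φ) : IsMaxStationary P fun n w => φ (Z n w) := fun v ℓ => by
  have hA : MeasurableSet {x | v < φ x} := measurableSet_lt measurable_const hφ
  have hstart := (h.measureReal_forall_notMem hμ hA 1 ℓ).trans
    (h.measureReal_forall_notMem hμ hA 0 ℓ).symm
  simpa only [mem_ofPred_eq, not_lt, zero_add, blockMax_le_iff, partialMax_le_iff,
    Finset.range_eq_Ico] using hstart

theorem exponentialExtremes [IsMarkovKernel κ] (h : IsMarkovChain κ μ P Z) (hμ : κ.Invariant μ)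
    {ν : Measure M} {N : ℕ} (hN : 0 < N) (hν0 : ν ≠ 0) (hν : ∀ᵐ x ∂μ, ν ≤ (κ ^ N) x) {C : ℝ≥0}
    (hC : ∀ᵐ x ∂μ, κ x ≤ C • μ) {φ : M → EReal} (hφ : Measurable φ) (hbot : essSup φ μ ≠ ⊥)
    (hcont : ∀ᶠ u in 𝓝 (essSup φ μ), ContinuousAt (fun v => μ {x | v < φ x}) u) :
    ExponentialExtremes P fun n w => φ (Z n w) := by
  have := h.prob
  have := h.isProbabilityMeasure
  have hA (v : EReal) : MeasurableSet {x | v < φ x} := measurableSet_lt measurable_const hφ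
  have hess : essSup (fun w => φ (Z 0 w)) P = essSup φ μ := by
    rw [← h.initial]
    exact (essSup_map_measure hφ.aemeasurable (h.measurable 0).aemeasurable).symm
  have htail (v : EReal) : P {w | v < φ (Z 0 w)} = μ {x | v < φ x} := by
    rw [← h.initial, Measure.map_apply (h.measurable 0) (hA v)]
    rfl
  have hrate : (1 - ν univ).toReal < 1 := by
    have : 1 - ν univ < 1 := ENNReal.sub_lt_self ENNReal.one_ne_top one_ne_zero
      (Measure.measure_univ_ne_zero.2 hν0)
    simpa using ENNReal.toReal_strict_mono ENNReal.one_ne_top this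
  refine exponentialExtremes_of_mixing (r := fun s => (1 - ν univ).toReal ^ (s / N)) (C := C)
    (hφ.comp (h.measurable 0)) (h.isMaxStationary hμ hφ) (hess ▸ hbot)
    (by simpa only [hess, htail] using hcont)
    (fun s s' hs => pow_le_pow_of_le_one ENNReal.toReal_nonneg hrate.le
      (Nat.div_le_div_right hs))
    ((tendsto_pow_atTop_nhds_zero_of_lt_one ENNReal.toReal_nonneg hrate).comp
      (Nat.tendsto_div_const_atTop hN.ne'))
    (fun v ℓ s => ?_) C.2 fun v j hj => ?_
  · have hmix := h.abs_measureReal_forall_notMem_sub_le hμ hν (hA v) s ℓ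
    simpa only [← h.measureReal_mem (hA v), mem_ofPred_eq, not_lt, blockMax_le_iff,
      partialMax_le_iff] using hmix
  · simpa only [← h.measureReal_mem (hA v), mem_ofPred_eq] using
      h.measureReal_mem_mem_le hμ hC (hA v) hj

end IsMarkovChain

end Chains

section Noise

variable {M : Type*} [MetricSpace M] {f : M → M}

theorem exists_orbit_dist_lt [ConnectedSpace M] {x₀ : M}
    (hdense : DenseRange fun n : ℕ => f^[n] x₀) (K : ℕ) (y : M) {δ : ℝ} (hδ : 0 < δ) :
    ∃ k, K ≤ k ∧ dist (f^[k] x₀) y < δ := by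
  rcases subsingleton_or_nontrivial M with hM | hM
  · exact ⟨K, le_rfl, by rwa [Subsingleton.elim (f^[K] x₀) y, dist_self]⟩
  · have hfin : ((fun n : ℕ => f^[n] x₀) '' Iio K).Finite := (finite_Iio K).image _
    obtain ⟨z, ⟨⟨k, rfl⟩, hk⟩, hz⟩ := (hdense.sdiff_finite hfin).exists_dist_lt y hδ
    refine ⟨k, not_lt.1 fun hlt => hk ⟨k, hlt, rfl⟩, ?_⟩
    rwa [dist_comm]

variable [MeasurableSpace M] {m : Measure M}

/-- The kernel `κ` smears the mass of the `r`-ball about `x` over the `r`-ball about `y` in `n`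
steps: started from `m` on the former, its law dominates a positive multiple of `m` on the
latter. -/
def Reach (κ : Kernel M M) (m : Measure M) (r : ℝ) (n : ℕ) (x y : M) : Prop :=
  ∃ c : ℝ≥0, c ≠ 0 ∧ c • m.restrict (Metric.ball y r) ≤ (κ ^ n) ∘ₘ m.restrict (Metric.ball x r)

/-- Two points from which a common point can be reached in the same number of steps. -/
def Coalesce (κ : Kernel M M) (m : Measure M) (r : ℝ) (x y : M) : Prop :=
  ∃ n z, Reach κ m r n x z ∧ Reach κ m r n y z

variable {κ : Kernel M M} {r : ℝ} {n k : ℕ} {x y z : M}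

theorem Reach.refl (x : M) : Reach κ m r 0 x x :=
  ⟨1, one_ne_zero, (one_smul ℝ≥0 _).trans_le (Measure.id_comp (μ := m.restrict _)).ge⟩

theorem Reach.trans (hxy : Reach κ m r n x y) (hyz : Reach κ m r k y z) :
    Reach κ m r (n + k) x z := by
  obtain ⟨c, hc, hle⟩ := hxy
  obtain ⟨c', hc', hle'⟩ := hyz
  refine ⟨c * c', mul_ne_zero hc hc', ?_⟩
  calc (c * c') • m.restrict (Metric.ball z r)
      = c • c' • m.restrict (Metric.ball z r) := mul_smul ..
    _ ≤ c • ((κ ^ k) ∘ₘ m.restrict (Metric.ball y r)) := by gcongr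
    _ = (κ ^ k) ∘ₘ (c • m.restrict (Metric.ball y r)) := (Measure.comp_smul _).symm
    _ ≤ (κ ^ k) ∘ₘ ((κ ^ n) ∘ₘ m.restrict (Metric.ball x r)) := comp_mono hle
    _ = (κ ^ (n + k)) ∘ₘ m.restrict (Metric.ball x r) := by rw [← pow_add_comp, add_comm]

theorem Reach.eventually_smul_le (h : Reach κ m r n x y) : ∀ᶠ c : ℝ≥0 in 𝓝[>] 0,
    c • m.restrict (Metric.ball y r) ≤ (κ ^ n) ∘ₘ m.restrict (Metric.ball x r) := by
  obtain ⟨c₀, hc₀, hle⟩ := h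
  filter_upwards [mem_nhdsWithin_of_mem_nhds (Iic_mem_nhds (pos_iff_ne_zero.2 hc₀))] with c hc
  refine le_trans ?_ hle
  gcongr
  exact hc

theorem Coalesce.symm (h : Coalesce κ m r x y) : Coalesce κ m r y x :=
  let ⟨n, z, hxz, hyz⟩ := h
  ⟨n, z, hyz, hxz⟩

/-- Around `m`-almost every `f x` the kernel `κ` charges balls of a fixed size at least as much as
`c • m`, and `f` has a dense orbit, contained in a set `Y` of full measure on which `f` is
continuous. The radius is `4 * r` so that `κ x` dominates `c • m` on the `r`-ball about each point
`3 * r`-close to `f x`. -/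
structure IsTransitiveNoise (κ : Kernel M M) (m : Measure M) (f : M → M) (Y : Set M) (x₀ : M)
    (r : ℝ) (c : ℝ≥0) : Prop where
  radius_pos : 0 < r
  coeff_ne_zero : c ≠ 0
  lower : ∀ᵐ x ∂m, c • m.restrict (Metric.ball (f x) (4 * r)) ≤ κ x
  ae_mem : ∀ᵐ x ∂m, x ∈ Y
  continuousOn : ContinuousOn f Y
  dense : DenseRange fun n : ℕ => f^[n] x₀
  orbit_mem : ∀ n : ℕ, f^[n] x₀ ∈ Y

namespace IsTransitiveNoise

variable {Y : Set M} {x₀ : M} {c : ℝ≥0}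

theorem smul_restrict_ball_le (h : IsTransitiveNoise κ m f Y x₀ r c) :
    ∀ᵐ x ∂m, ∀ y, dist (f x) y < 3 * r → c • m.restrict (Metric.ball y r) ≤ κ x := by
  filter_upwards [h.lower] with x hx y hy
  have hball : Metric.ball y r ⊆ Metric.ball (f x) (4 * r) :=
    Metric.ball_subset_ball' (by rw [dist_comm y]; linarith)
  refine le_trans ?_ hx
  gcongr

variable [OpensMeasurableSpace M] [m.IsOpenPosMeasure]

theorem reach_one (h : IsTransitiveNoise κ m f Y x₀ r c) (hx : dist (f^[k] x₀) x < r)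
    (hy : dist (f^[k + 1] x₀) y < 2 * r) : Reach κ m r 1 x y := by
  rw [Function.iterate_succ_apply'] at hy
  obtain ⟨U, hU, hkU, hUY⟩ := mem_nhdsWithin.1
    (h.continuousOn _ (h.orbit_mem k) (Metric.ball_mem_nhds _ h.radius_pos))
  have hV : IsOpen (U ∩ Metric.ball x r) := hU.inter Metric.isOpen_ball
  obtain ⟨a, ha0, haV⟩ := ENNReal.lt_iff_exists_nnreal_btwn.1 (hV.measure_pos m ⟨_, hkU, hx⟩)
  have hlower : ∀ᵐ x' ∂m.restrict (U ∩ Metric.ball x r),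
      c • m.restrict (Metric.ball y r) ≤ κ x' := by
    refine (ae_restrict_iff' hV.measurableSet).2 ?_
    filter_upwards [h.ae_mem, h.smul_restrict_ball_le] with x' hx'Y hle hx'V
    have hfx' : dist (f x') (f (f^[k] x₀)) < r := hUY ⟨hx'V.1, hx'Y⟩
    exact hle y (by linarith [dist_triangle (f x') (f (f^[k] x₀)) y])
  refine ⟨a * c, mul_ne_zero (by simpa using ha0.ne') h.coeff_ne_zero, ?_⟩
  rw [pow_one]
  calc (a * c) • m.restrict (Metric.ball y r)
      = a • c • m.restrict (Metric.ball y r) := mul_smul ..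
    _ ≤ m.restrict (U ∩ Metric.ball x r) univ • c • m.restrict (Metric.ball y r) := by
        rw [Measure.restrict_apply_univ, ← Measure.coe_nnreal_smul]
        gcongr
    _ ≤ κ ∘ₘ m.restrict (U ∩ Metric.ball x r) := smul_le_comp_of_ae_le hlower
    _ ≤ κ ∘ₘ m.restrict (Metric.ball x r) :=
        comp_mono (Measure.restrict_mono_set m inter_subset_right)

theorem reach_orbit (h : IsTransitiveNoise κ m f Y x₀ r c) (hx : dist (f^[k] x₀) x < r) (n : ℕ)
    (hy : dist (f^[k + n + 1] x₀) y < r) : Reach κ m r (n + 1) x y := by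
  have hr := h.radius_pos
  induction n generalizing y with
  | zero => exact h.reach_one hx (by rw [Nat.add_zero] at hy; linarith)
  | succ n ih =>
    exact (ih (by rwa [dist_self])).trans
      (h.reach_one (k := k + n + 1) (by rwa [dist_self]) (hy.trans (by linarith)))

variable [ConnectedSpace M]

theorem exists_reach (h : IsTransitiveNoise κ m f Y x₀ r c) (x y : M) :
    ∃ n, Reach κ m r n x y := by
  obtain ⟨k, -, hk⟩ := exists_orbit_dist_lt h.dense 0 x h.radius_pos
  obtain ⟨l, hkl, hl⟩ := exists_orbit_dist_lt h.dense (k + 1) y h.radius_pos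
  obtain ⟨n, rfl⟩ := Nat.exists_eq_add_of_le hkl
  exact ⟨n + 1, h.reach_orbit hk n (by rwa [add_right_comm])⟩

theorem exists_reach_of_steps (h : IsTransitiveNoise κ m f Y x₀ r c) (x : M) (n : ℕ) :
    ∃ y, Reach κ m r n x y := by
  obtain ⟨k, -, hk⟩ := exists_orbit_dist_lt h.dense 0 x h.radius_pos
  cases n with
  | zero => exact ⟨x, Reach.refl x⟩
  | succ n => exact ⟨_, h.reach_orbit hk n ((dist_self _).trans_lt h.radius_pos)⟩

theorem coalesce_trans (h : IsTransitiveNoise κ m f Y x₀ r c) (hxy : Coalesce κ m r x y)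
    (hyz : Coalesce κ m r y z) : Coalesce κ m r x z := by
  obtain ⟨n, a, hxa, hya⟩ := hxy
  obtain ⟨k, b, hyb, hzb⟩ := hyz
  obtain ⟨s, hs⟩ := h.exists_reach a y
  obtain ⟨t, ht⟩ := h.exists_reach b y
  refine ⟨(n + s) + (k + t), y, (hxa.trans hs).trans (hyb.trans ht), ?_⟩
  rw [add_comm]
  exact (hzb.trans ht).trans (hya.trans hs)

theorem coalesce_of_dist_lt (h : IsTransitiveNoise κ m f Y x₀ r c) (hxy : dist x y < r) :
    Coalesce κ m r x y := by
  have hr := h.radius_pos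
  obtain ⟨l, hl, hlx⟩ := exists_orbit_dist_lt h.dense 1 x hr
  obtain ⟨k, rfl⟩ := Nat.exists_eq_add_of_le' hl
  have hself : dist (f^[k] x₀) (f^[k] x₀) < r := by rwa [dist_self]
  have hwx : Reach κ m r 1 (f^[k] x₀) x := h.reach_one hself (by linarith)
  have hwy : Reach κ m r 1 (f^[k] x₀) y :=
    h.reach_one hself (by linarith [dist_triangle (f^[k + 1] x₀) x y])
  obtain ⟨a, hxw⟩ := h.exists_reach x (f^[k] x₀)
  obtain ⟨b, hyw⟩ := h.exists_reach y (f^[k] x₀)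
  -- The routes `x → w → y → w` and `y → w → x → w` through `w = f^[k] x₀` have the same length.
  refine ⟨a + (1 + b), _, hxw.trans (hwy.trans hyw), ?_⟩
  rw [show a + (1 + b) = b + (1 + a) by ring]
  exact hyw.trans (hwx.trans hxw)

theorem coalesce (h : IsTransitiveNoise κ m f Y x₀ r c) (x y : M) : Coalesce κ m r x y := by
  have hclopen : IsClopen {y | Coalesce κ m r x y} := by
    refine ⟨⟨Metric.isOpen_iff.2 fun y hy => ⟨r, h.radius_pos, fun z hzy hz => hy ?_⟩⟩,
      Metric.isOpen_iff.2 fun y hy => ⟨r, h.radius_pos, fun z hzy => ?_⟩⟩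
    · exact h.coalesce_trans hz (h.coalesce_of_dist_lt hzy)
    · exact h.coalesce_trans hy (h.coalesce_of_dist_lt hzy).symm
  exact (hclopen.eq_univ ⟨x, 0, x, Reach.refl x, Reach.refl x⟩).ge (mem_univ y)

theorem exists_common_reach (h : IsTransitiveNoise κ m f Y x₀ r c) (S : Finset M) :
    ∃ n y, ∀ z ∈ S, Reach κ m r n z y := by
  classical
  induction S using Finset.induction_on with
  | empty => exact ⟨0, x₀, by simp⟩
  | insert z S _ ih =>
    obtain ⟨n, y, hy⟩ := ih
    obtain ⟨w, hzw⟩ := h.exists_reach_of_steps z n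
    obtain ⟨k, v, hyv, hwv⟩ := h.coalesce y w
    refine ⟨n + k, v, (Finset.forall_mem_insert ..).2 ⟨hzw.trans hwv, fun z' hz' => ?_⟩⟩
    exact (hy z' hz').trans hyv

variable [CompactSpace M]

theorem exists_doeblin (h : IsTransitiveNoise κ m f Y x₀ r c) :
    ∃ (N : ℕ) (y : M) (b : ℝ≥0), 0 < N ∧ b ≠ 0 ∧
      ∀ᵐ x ∂m, b • m.restrict (Metric.ball y r) ≤ (κ ^ N) x := by
  have hr := h.radius_pos
  obtain ⟨S, -, hfin, hS⟩ := finite_cover_balls_of_compact (isCompact_univ (X := M)) hr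
  obtain ⟨n, y, hy⟩ := h.exists_common_reach hfin.toFinset
  obtain ⟨a, hle, ha⟩ := (((Finset.eventually_all _).2 fun z hz =>
    (hy z hz).eventually_smul_le).and self_mem_nhdsWithin).exists
  refine ⟨n + 1, y, c * a, n.succ_pos, mul_ne_zero h.coeff_ne_zero (ne_of_gt ha), ?_⟩
  filter_upwards [h.smul_restrict_ball_le] with x hx
  obtain ⟨z, hz, hxz⟩ := mem_iUnion₂.1 (hS (mem_univ (f x)))
  rw [Metric.mem_ball] at hxz
  calc (c * a) • m.restrict (Metric.ball y r)
      = c • a • m.restrict (Metric.ball y r) := mul_smul ..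
    _ ≤ c • ((κ ^ n) ∘ₘ m.restrict (Metric.ball z r)) := by
        gcongr; exact hle z (hfin.mem_toFinset.2 hz)
    _ = (κ ^ n) ∘ₘ (c • m.restrict (Metric.ball z r)) := (Measure.comp_smul _).symm
    _ ≤ (κ ^ n) ∘ₘ κ x := comp_mono (hx z (by linarith))
    _ = (κ ^ (n + 1)) x := by rw [pow_succ]; exact (Kernel.comp_apply ..).symm

theorem exists_le_smul (h : IsTransitiveNoise κ m f Y x₀ r c) {μ : Measure M}
    [IsProbabilityMeasure μ] (hμ : κ.Invariant μ) (hμm : μ ≪ m) : ∃ C : ℝ≥0, m ≤ C • μ := by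
  obtain ⟨N, y, b, -, hb, hdoeb⟩ := h.exists_doeblin
  have hby : b • m.restrict (Metric.ball y r) ≤ μ := by
    have hle := smul_le_comp_of_ae_le (hμm.ae_le hdoeb)
    rwa [measure_univ, one_smul, (invariant_pow hμ N).def] at hle
  have hball (z : M) : ∃ C : ℝ≥0, m.restrict (Metric.ball z r) ≤ C • μ := by
    obtain ⟨n, a, ha, hle⟩ := h.exists_reach y z
    refine ⟨(b * a)⁻¹, (inv_smul_smul₀ (mul_ne_zero hb ha) _).ge.trans ?_⟩
    gcongr
    calc (b * a) • m.restrict (Metric.ball z r)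
        = b • a • m.restrict (Metric.ball z r) := mul_smul ..
      _ ≤ b • ((κ ^ n) ∘ₘ m.restrict (Metric.ball y r)) := by gcongr
      _ = (κ ^ n) ∘ₘ (b • m.restrict (Metric.ball y r)) := (Measure.comp_smul _).symm
      _ ≤ (κ ^ n) ∘ₘ μ := comp_mono hby
      _ = μ := (invariant_pow hμ n).def
  suffices ∃ C : ℝ≥0, m.restrict univ ≤ C • μ by rwa [Measure.restrict_univ] at this
  refine isCompact_univ.induction_on (p := fun s => ∃ C : ℝ≥0, m.restrict s ≤ C • μ)
    ⟨0, by simp⟩ (fun s t hst ⟨C, hC⟩ => ⟨C, (Measure.restrict_mono_set m hst).trans hC⟩)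
    (fun s t ⟨C, hC⟩ ⟨C', hC'⟩ => ⟨C + C', ?_⟩)
    fun z _ => ⟨_, mem_nhdsWithin_of_mem_nhds (Metric.ball_mem_nhds z h.radius_pos), hball z⟩
  rw [add_smul]
  exact (Measure.restrict_union_le s t).trans (add_le_add hC hC')

end IsTransitiveNoise

end Noise

theorem IsNormalizedVolume.isOpenPosMeasure {d : ℕ} {M : Type*} [TopologicalSpace M]
    [ChartedSpace (EuclideanSpace ℝ (Fin d)) M] [MeasurableSpace M] [OpensMeasurableSpace M]
    {m : Measure M} (h : IsNormalizedVolume d m) : m.IsOpenPosMeasure := by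
  refine ⟨fun U hU ⟨x, hx⟩ hU0 => ?_⟩
  set e := chartAt (EuclideanSpace ℝ (Fin d)) x
  obtain ⟨ρ, hρc, hρpos, hρ⟩ := h.density e (chart_mem_atlas _ x)
  have hV : IsOpen (U ∩ e.source) := hU.inter e.open_source
  have himg : IsOpen (e '' (U ∩ e.source)) := e.isOpen_image_of_subset_source hV inter_subset_right
  have hsub : e '' (U ∩ e.source) ⊆ e.target :=
    (image_mono inter_subset_right).trans_eq e.image_source_eq_target
  have hmeas : AEMeasurable (fun y => ENNReal.ofReal (ρ y))
      (volume.restrict (e '' (U ∩ e.source))) :=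
    ((hρc.mono hsub).aemeasurable himg.measurableSet).ennreal_ofReal
  have hnull := hρ _ inter_subset_right hV.measurableSet
  rw [measure_mono_null inter_subset_left hU0, eq_comm, lintegral_eq_zero_iff' hmeas,
    Filter.EventuallyEq, ae_restrict_iff' himg.measurableSet] at hnull
  have hpos : 0 < volume (e '' (U ∩ e.source)) :=
    himg.measure_pos volume ⟨e x, x, ⟨hx, mem_chart_source _ x⟩, rfl⟩
  refine hpos.ne' (measure_mono_null ?_ (ae_iff.1 hnull))
  exact fun y hy hy0 => (ENNReal.ofReal_pos.2 (hρpos y (hsub hy))).ne' (hy0 hy)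

theorem IsTopologicalBall.isOpen {d : ℕ} {M : Type*} [TopologicalSpace M] {U : Set M} {ζ : M}
    (h : IsTopologicalBall d U ζ) : IsOpen U := by
  obtain ⟨e, -, rfl, -⟩ := h
  exact e.open_target

theorem IsTopologicalBall.center_mem {d : ℕ} {M : Type*} [TopologicalSpace M] {U : Set M} {ζ : M}
    (h : IsTopologicalBall d U ζ) : ζ ∈ U := by
  obtain ⟨e, hsource, rfl, rfl⟩ := h
  exact e.map_source (hsource ▸ Metric.mem_ball_self one_pos)

theorem IsRegularObservable.essSup_eq {d : ℕ} {M : Type*} [TopologicalSpace M]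
    [MeasurableSpace M] {μ : Measure M} {φ : M → EReal} {ζ : M}
    (h : IsRegularObservable d μ φ ζ) (m : Measure M) [m.IsOpenPosMeasure] :
    essSup φ m = φ ζ := by
  refine (essSup_le_of_ae_le _ (Eventually.of_forall h.max)).antisymm (not_lt.1 fun hlt => ?_)
  have : (𝓝[<] (φ ζ)).NeBot := nhdsLT_neBot_of_exists_lt ⟨_, hlt⟩
  obtain ⟨u, hball, hu⟩ := (h.ball.and (Ioo_mem_nhdsLT hlt)).exists
  exact (hball.isOpen.measure_pos m ⟨ζ, hball.center_mem⟩).ne' <|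
    measure_eq_zero_iff_ae_notMem.2 <| (ae_lt_of_essSup_lt hu.1).mono fun x hx => hx.not_gt

section RandomMaps

variable {M X : Type*} {F : M → X → M}

theorem randomOrbit_update (w : ℕ → X) {n i : ℕ} (hi : i ≤ n) (v : X) (x : M) :
    randomOrbit F (Function.update w n v) i x = randomOrbit F w i x := by
  induction i with
  | zero => rfl
  | succ i ih => simp only [randomOrbit, ih (by omega), Function.update_of_ne (by omega : i ≠ n)]

theorem randomOrbit_update_succ (w : ℕ → X) (n : ℕ) (v : X) (x : M) :
    randomOrbit F (Function.update w n v) (n + 1) x = F (randomOrbit F w n x) v := by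
  simp only [randomOrbit, randomOrbit_update w le_rfl, Function.update_self]

variable [MeasurableSpace M] [MeasurableSpace X]

theorem measurable_map_of_uncurry (hF : Measurable (Function.uncurry F)) (θ : Measure X)
    [SFinite θ] : Measurable fun x => θ.map (F x) := by
  refine Measure.measurable_of_measurable_coe _ fun A hA => ?_
  simp only [Measure.map_apply hF.of_uncurry_left hA]
  exact measurable_measure_prodMk_left (hF hA)

theorem measurable_randomOrbit (hF : Measurable (Function.uncurry F)) (n : ℕ) :
    Measurable fun z : M × (ℕ → X) => randomOrbit F z.2 n z.1 := by
  induction n with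
  | zero => exact measurable_fst
  | succ n ih => exact hF.comp (ih.prodMk ((measurable_pi_apply n).comp measurable_snd))

theorem preimage_update_pi {ι X : Type*} [DecidableEq ι] (s : Finset ι) (t : ι → Set X) (i : ι) :
    (fun p : (ι → X) × X => Function.update p.1 i p.2) ⁻¹' Set.pi s t =
      Set.pi (s.erase i) t ×ˢ (if i ∈ s then t i else univ) := by
  ext ⟨w, v⟩
  simp only [mem_preimage, Set.mem_pi, Finset.mem_coe, mem_prod, Finset.mem_erase]
  constructor
  · refine fun hw => ⟨fun j hj => by simpa [hj.1] using hw j hj.2, ?_⟩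
    split_ifs with hi
    · simpa using hw i hi
    · trivial
  · rintro ⟨hw, hv⟩ j hj
    by_cases hji : j = i
    · subst hji; simpa [hj] using hv
    · simpa [hji] using hw j ⟨hji, hj⟩

theorem measurePreserving_update (θ : Measure X) [IsProbabilityMeasure θ] (n : ℕ) :
    MeasurePreserving (fun p : (ℕ → X) × X => Function.update p.1 n p.2)
      ((Measure.infinitePi fun _ : ℕ => θ).prod θ) (Measure.infinitePi fun _ : ℕ => θ) := by
  have hmeas : Measurable fun p : (ℕ → X) × X => Function.update p.1 n p.2 := by fun_prop
  refine ⟨hmeas, Measure.eq_infinitePi _ fun s t ht => ?_⟩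
  rw [Measure.map_apply hmeas (.pi s.countable_toSet fun i _ => ht i), preimage_update_pi,
    Measure.prod_prod, Measure.infinitePi_pi _ fun i _ => ht i]
  split_ifs with hn
  · exact Finset.prod_erase_mul _ _ hn
  · rw [measure_univ, mul_one, Finset.erase_eq_of_notMem hn]

theorem measurePreserving_resample (θ : Measure X) [IsProbabilityMeasure θ] (μ : Measure M)
    [SFinite μ] (n : ℕ) :
    MeasurePreserving (fun p : (M × (ℕ → X)) × X => (p.1.1, Function.update p.1.2 n p.2))
      ((μ.prod (Measure.infinitePi fun _ : ℕ => θ)).prod θ)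
      (μ.prod (Measure.infinitePi fun _ : ℕ => θ)) :=
  ((MeasurePreserving.id μ).prod (measurePreserving_update θ n)).comp
    (measurePreserving_prodAssoc μ (Measure.infinitePi fun _ : ℕ => θ) θ)

theorem isMarkovChain_randomOrbit (hF : Measurable (Function.uncurry F)) (θ : Measure X)
    [IsProbabilityMeasure θ] (μ : Measure M) [IsProbabilityMeasure μ] :
    IsMarkovChain (fun x => θ.map (F x)) μ (μ.prod (Measure.infinitePi fun _ : ℕ => θ))
      (fun n z => randomOrbit F z.2 n z.1) := by
  have hZ := measurable_randomOrbit hF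
  refine ⟨inferInstance, hZ, measurePreserving_fst.map_eq, fun n B A hB hA => ?_⟩
  set Q := μ.prod (Measure.infinitePi fun _ : ℕ => θ)
  set S := {z : M × (ℕ → X) | (fun i : Fin (n + 1) => randomOrbit F z.2 i z.1) ∈ B}
  have hS : MeasurableSet S := hB.preimage (measurable_pi_lambda _ fun i => hZ i)
  have hG : Measurable fun p : (M × (ℕ → X)) × X => F (randomOrbit F p.1.2 n p.1.1) p.2 :=
    hF.comp (((hZ n).comp measurable_fst).prodMk measurable_snd)
  have hresample : (fun p : (M × (ℕ → X)) × X => (p.1.1, Function.update p.1.2 n p.2)) ⁻¹'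
      (S ∩ {z | randomOrbit F z.2 (n + 1) z.1 ∈ A}) =
      (fun p : (M × (ℕ → X)) × X => F (randomOrbit F p.1.2 n p.1.1) p.2) ⁻¹' A ∩ S ×ˢ univ := by
    ext ⟨⟨x, w⟩, v⟩
    simp [S, randomOrbit_update_succ, randomOrbit_update w (Nat.lt_succ_iff.1 (Fin.is_lt _)),
      and_comm]
  calc Q (S ∩ {z | randomOrbit F z.2 (n + 1) z.1 ∈ A})
      = (Q.prod θ) ((fun p => F (randomOrbit F p.1.2 n p.1.1) p.2) ⁻¹' A ∩ S ×ˢ univ) := by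
        rw [← hresample]
        exact ((measurePreserving_resample θ μ n).measure_preimage
          (hS.inter (hA.preimage (hZ (n + 1)))).nullMeasurableSet).symm
    _ = ((Q.restrict S).prod θ) ((fun p => F (randomOrbit F p.1.2 n p.1.1) p.2) ⁻¹' A) := by
        rw [← Measure.restrict_apply (hG hA), ← Measure.prod_restrict, Measure.restrict_univ]
    _ = ∫⁻ z in S, θ (F (randomOrbit F z.2 n z.1) ⁻¹' A) ∂Q := Measure.prod_apply (hG hA)
    _ = ∫⁻ z in S, θ.map (F (randomOrbit F z.2 n z.1)) A ∂Q := by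
        simp only [Measure.map_apply hF.of_uncurry_left hA]

end RandomMaps

section Perturbations

variable {M : Type*} [MeasurableSpace M] {m : Measure M}

theorem withDensity_le_smul {g : M → ℝ} {b : ℝ} (h : ∀ᵐ y ∂m, g y ≤ b) :
    m.withDensity (fun y => ENNReal.ofReal (g y)) ≤ b.toNNReal • m := by
  rw [← Measure.coe_nnreal_smul, ← withDensity_const]
  exact withDensity_mono (h.mono fun y hy => ENNReal.ofReal_le_ofReal hy)

theorem smul_le_withDensity {g : M → ℝ} {a : ℝ} (h : ∀ᵐ y ∂m, a ≤ g y) :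
    a.toNNReal • m ≤ m.withDensity (fun y => ENNReal.ofReal (g y)) := by
  rw [← Measure.coe_nnreal_smul, ← withDensity_const]
  exact withDensity_mono (h.mono fun y hy => ENNReal.ofReal_le_ofReal hy)

variable [PseudoMetricSpace M] {f : M → M}

/-- Transition probabilities `(p x)` which perturb `f` by absolutely continuous noise: almost every
`p x` is dominated by a multiple of `m` and charges a ball of fixed radius about `f x` at least as
much as a fixed multiple of `m`. This is what the two kinds of perturbation have in common. -/
structure IsNoisyPerturbation (m : Measure M) (f : M → M) (p : M → Measure M) : Prop where
  measurable : Measurable p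
  prob : ∀ x, IsProbabilityMeasure (p x)
  upper : ∃ C : ℝ≥0, ∀ᵐ x ∂m, p x ≤ C • m
  lower : ∃ r > 0, ∃ c : ℝ≥0, c ≠ 0 ∧ ∀ᵐ x ∂m, c • m.restrict (Metric.ball (f x) r) ≤ p x

theorem IsRandomPerturbation.isNoisyPerturbation [OpensMeasurableSpace M]
    [HereditarilyLindelofSpace M]
    {X : Type*} [PseudoMetricSpace X] [MeasurableSpace X] {F : M → X → M} {ωstar : X}
    {θ : Measure X} (h : IsRandomPerturbation m f F ωstar θ) :
    IsNoisyPerturbation m f fun x => θ.map (F x) := by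
  have := h.prob
  obtain ⟨r, hr, hcover⟩ := h.cover
  obtain ⟨a, b, ha, -, hdens⟩ := h.density
  have hsupp (x : M) : MeasurableSet (θ.map (F x)).support :=
    Measure.isClosed_support.measurableSet
  refine ⟨measurable_map_of_uncurry h.measurable θ,
    fun x => Measure.isProbabilityMeasure_map h.measurable.of_uncurry_left.aemeasurable,
    ⟨b.toNNReal, ?_⟩, r, hr, a.toNNReal, (Real.toNNReal_pos.2 ha).ne', ?_⟩
  · filter_upwards [hdens] with x ⟨q, _, hq, hbound⟩
    have hbound' : ∀ᵐ y ∂m.restrict (θ.map (F x)).support, q y ≤ b :=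
      (ae_restrict_iff' (hsupp x)).2 (hbound.mono fun y hy hys => (hy hys).2)
    calc θ.map (F x) = (θ.map (F x)).restrict (θ.map (F x)).support :=
          (Measure.restrict_eq_self_of_ae_mem Measure.support_mem_ae).symm
      _ = (m.restrict (θ.map (F x)).support).withDensity fun y => ENNReal.ofReal (q y) :=
          (congrArg (Measure.restrict · (θ.map (F x)).support) hq).trans
            (restrict_withDensity (hsupp x) _)
      _ ≤ b.toNNReal • m.restrict (θ.map (F x)).support := withDensity_le_smul hbound'
      _ ≤ b.toNNReal • m := by gcongr; exact Measure.restrict_le_self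
  · filter_upwards [hdens, hcover] with x ⟨q, _, hq, hbound⟩ hball
    refine (smul_le_withDensity (g := q) ?_).trans ?_
    · exact (ae_restrict_iff' Metric.isOpen_ball.measurableSet).2
        (hbound.mono fun y hy hyb => (hy (hball hyb)).1)
    · rw [← restrict_withDensity Metric.isOpen_ball.measurableSet, ← hq]
      exact Measure.restrict_le_self

variable {q : C(M, C(M, ℝ))}

theorem measurable_densityTransition [OpensMeasurableSpace M] [SecondCountableTopology M]
    [LocallyCompactSpace M] [SFinite m] : Measurable (densityTransition m q) := by
  have hq : Continuous fun z : M × M => q z.1 z.2 :=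
    ContinuousMap.continuous_uncurry_of_continuous q
  refine Measure.measurable_of_measurable_coe _ fun A hA => ?_
  simp only [densityTransition, withDensity_apply _ hA]
  exact Measurable.lintegral_prod_right' (ν := m.restrict A)
    (f := fun z : M × M => ENNReal.ofReal (q z.1 z.2)) hq.measurable.ennreal_ofReal

theorem IsMarkovPerturbation.isProbabilityMeasure {Y : Set M} (h : IsMarkovPerturbation m f Y q)
    (x : M) : IsProbabilityMeasure (densityTransition m q x) := by
  have hint : Integrable (q x) m :=
    not_imp_comm.1 integral_undef ((h.prob x).trans_ne one_ne_zero)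
  refine ⟨?_⟩
  rw [densityTransition, withDensity_apply _ .univ, Measure.restrict_univ,
    ← ofReal_integral_eq_lintegral_ofReal hint (Eventually.of_forall fun y => (h.pos x y).le),
    h.prob x, ENNReal.ofReal_one]

theorem IsMarkovPerturbation.isNoisyPerturbation [OpensMeasurableSpace M]
    [SecondCountableTopology M] [LocallyCompactSpace M] [SFinite m] {Y : Set M}
    (h : IsMarkovPerturbation m f Y q) (hY : ∀ᵐ x ∂m, x ∈ Y) :
    IsNoisyPerturbation m f (densityTransition m q) := by
  obtain ⟨a, b, ha, -, hbound⟩ := h.bounds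
  refine ⟨measurable_densityTransition, h.isProbabilityMeasure,
    ⟨b.toNNReal, hY.mono fun x hx => ?_⟩,
    1, one_pos, a.toNNReal, (Real.toNNReal_pos.2 ha).ne', hY.mono fun x hx => ?_⟩
  · exact withDensity_le_smul (Eventually.of_forall fun y => (hbound x hx y).2)
  · refine le_trans (by gcongr; exact Measure.restrict_le_self)
      (smul_le_withDensity (Eventually.of_forall fun y => (hbound x hx y).1))

end Perturbations

end RandomEVL

theorem theoremC_general {M Ω : Type*} [MetricSpace M] [CompactSpace M] [ConnectedSpace M]
    [MeasurableSpace M] [OpensMeasurableSpace M] [MeasurableSpace Ω] {m μ : Measure M}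
    [m.IsOpenPosMeasure] {f : M → M} {Y : Set M} (hY : ∀ᵐ x ∂m, x ∈ Y) (hfY : ContinuousOn f Y)
    {x₀ : M} (hdense : DenseRange fun n : ℕ => f^[n] x₀) (horbit : ∀ n : ℕ, f^[n] x₀ ∈ Y)
    {p : M → Measure M} (hp : IsNoisyPerturbation m f p) (hμ : IsStationaryMeasure p μ)
    (hac : ∀ᵐ x ∂μ, p x ≪ m) {φ : M → EReal} (hφ : Measurable φ) (hbot : essSup φ m ≠ ⊥)
    (hcont : ∀ᶠ u in 𝓝 (essSup φ m), ContinuousAt (fun v => μ {x | v < φ x}) u)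
    {P : Measure Ω} {Z : ℕ → Ω → M} (hZ : IsMarkovChain p μ P Z) :
    ExponentialExtremes P fun n w => φ (Z n w) := by
  let κ : ProbabilityTheory.Kernel M M := ⟨p, hp.measurable⟩
  have : ProbabilityTheory.IsMarkovKernel κ := ⟨hp.prob⟩
  have hZ : IsMarkovChain κ μ P Z := hZ
  have := hZ.isProbabilityMeasure
  obtain ⟨r, hr, c, hc, hlower⟩ := hp.lower
  obtain ⟨C, hupper⟩ := hp.upper
  have hκ : IsTransitiveNoise κ m f Y x₀ (r / 4) c :=
    ⟨by positivity, hc, by rwa [mul_div_cancel₀ r four_ne_zero], hY, hfY, hdense, horbit⟩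
  have hinv : κ.Invariant μ := invariant_of_isStationaryMeasure hμ
  have hμm : μ ≪ m := absolutelyContinuous_of_invariant hinv hac
  obtain ⟨D, hmD⟩ := hκ.exists_le_smul hinv hμm
  have hess : essSup φ m = essSup φ μ :=
    le_antisymm (essSup_mono_measure (Measure.absolutelyContinuous_of_le_smul hmD))
      (essSup_mono_measure hμm)
  obtain ⟨N, y, b, hN, hb, hdoeblin⟩ := hκ.exists_doeblin
  have hminorant : b • m.restrict (Metric.ball y (r / 4)) ≠ 0 := by
    simp [hb, (Metric.measure_ball_pos m y hκ.radius_pos).ne']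
  have hdensity : ∀ᵐ x ∂μ, κ x ≤ (C * D) • μ := by
    filter_upwards [hμm.ae_le hupper] with x hx
    exact hx.trans (by rw [mul_smul]; gcongr)
  exact hZ.exponentialExtremes hinv hN hminorant (hμm.ae_le hdoeblin) hdensity hφ
    (hess ▸ hbot) (hess ▸ hcont)

theorem theoremC {d : ℕ} {M : Type*} [MetricSpace M]
    [ChartedSpace (EuclideanSpace ℝ (Fin d)) M] [IsManifold (𝓡 d) ∞ M]
    [Bundle.RiemannianBundle (fun x : M => TangentSpace (𝓡 d) x)]
    [IsContMDiffRiemannianBundle (𝓡 d) ∞ (EuclideanSpace ℝ (Fin d))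
      (fun x : M => TangentSpace (𝓡 d) x)]
    [IsRiemannianManifold (𝓡 d) M] [CompactSpace M] [ConnectedSpace M]
    [MeasurableSpace M] [BorelSpace M]
    -- the normalised volume and the transitive map
    (Leb : Measure M) (hLeb : IsNormalizedVolume d Leb)
    (f : M → M) (Y : Set M) (hY : ∀ᵐ x ∂Leb, x ∈ Y) (hfY : ContinuousOn f Y)
    (x₀ : M) (hdense : DenseRange fun n : ℕ => f^[n] x₀) (horbit : ∀ n : ℕ, f^[n] x₀ ∈ Y)
    -- the stationary measure and the observable
    (μ : Measure M) [IsProbabilityMeasure μ]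
    (ζ : M) (φ : M → EReal) (hφ : IsRegularObservable d μ φ ζ) :
    -- perturbation by random maps
    (∀ (X : Type*) [MetricSpace X] [CompactSpace X] [MeasurableSpace X] [BorelSpace X]
      (F : M → X → M) (ωstar : X) (θ : Measure X),
      IsRandomPerturbation Leb f F ωstar θ →
      IsStationaryMeasure (fun x => θ.map (F x)) μ →
      (∀ᵐ x ∂μ, θ.map (F x) ≪ Leb) →
      ExponentialExtremes (μ.prod (Measure.infinitePi fun _ : ℕ => θ))
        (fun n z => φ (randomOrbit F z.2 n z.1))) ∧
    -- perturbation by a Markov chain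
    (∀ q : C(M, C(M, ℝ)), IsMarkovPerturbation Leb f Y q →
      IsStationaryMeasure (densityTransition Leb q) μ →
      ∀ (Ω : Type*) [MeasurableSpace Ω] (P : Measure Ω) (Z : ℕ → Ω → M),
        IsMarkovChain (densityTransition Leb q) μ P Z →
        ExponentialExtremes P (fun n w => φ (Z n w))) := by
  have := hLeb.prob
  have := hLeb.isOpenPosMeasure
  have hbot : essSup φ Leb ≠ ⊥ := hφ.essSup_eq Leb ▸ hφ.ne_bot
  have hcont : ∀ᶠ u in 𝓝 (essSup φ Leb), ContinuousAt (fun v => μ {x | v < φ x}) u :=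
    hφ.essSup_eq Leb ▸ hφ.continuous
  refine ⟨fun X _ _ _ _ F ωstar θ hF hμ hac => ?_, fun q hq hμ Ω _ P Z hZ => ?_⟩
  · have := hF.prob
    exact theoremC_general hY hfY hdense horbit hF.isNoisyPerturbation hμ hac hφ.measurable hbot
      hcont (isMarkovChain_randomOrbit hF.measurable θ μ)
  · exact theoremC_general hY hfY hdense horbit (hq.isNoisyPerturbation hY) hμ
      (Eventually.of_forall fun x => withDensity_absolutelyContinuous _ _) hφ.measurable hbot
      hcont hZ
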